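/- For an integer $n\ge 1$, consider the eigenvalue problem $$(-1)^n\psi^{(2n)}(t)=\lambda\,\psi(t)\quad(-1<t<1),\qquad \psi^{(j)}(\pm1)=0\quad(0\le j\le n-1).$$ A real number $\lambda$ is an eigenvalue if there is a solution $\psi\in C^{2n}([-1,1];\mathbb{R})$ that is not identically zero. Then this problem has a smallest eigenvalue, denoted $\lambda_n$, and for every $n\ge 1$ $$\frac{2\,\Gamma(n+1)\,\Gamma(2n+\frac12)}{\Gamma(n+\frac12)\,R_n}<\lambda_n<\frac{2\,\Gamma(n+1)\,\Gamma(2n+\frac12)}{\Gamma(n+\frac12)},$$ where $$R_n={}_3F_2\left(\tfrac12,1,-n;\,1-2n,\,n+1;\,1\right)=\sum_{k=0}^{n}\frac{(1/2)_k\,(1)_k\,(-n)_k}{(1-2n)_k\,(n+1)_k\,k!}$$ and $(a)_k=a(a+1)\cdots(a+k-1)$. Moreover, $R_n\to1$ as $n\to\infty$; consequently both the lower and the upper bound above are asymptotically equal to $\lambda_n$ as $n\to\infty$, and $$\lambda_n\sim\sqrt2\,(2n)!\qquad(n\to\infty).$$ -/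

import Mathlib

open Filter Topology Asymptotics Set

noncomputable section

/-- `ψ` belongs to `C^{2n}([-1,1])`, is not identically zero there, satisfies
`(-1)^n ψ^{(2n)} = μ ψ` on `(-1,1)`, and `ψ^{(j)}(±1) = 0` for `0 ≤ j ≤ n - 1`
(derivatives at the end points are one-sided). -/
structure IsPolyharmonicEigenfunction (n : ℕ) (μ : ℝ) (ψ : ℝ → ℝ) : Prop where
  contDiffOn : ContDiffOn ℝ (2 * n : ℕ) ψ (Icc (-1) 1)
  ne_zero : ∃ t ∈ Icc (-1 : ℝ) 1, ψ t ≠ 0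
  equation : ∀ t ∈ Ioo (-1 : ℝ) 1,
    (-1) ^ n * iteratedDerivWithin (2 * n) ψ (Icc (-1) 1) t = μ * ψ t
  left_boundary : ∀ j < n, iteratedDerivWithin j ψ (Icc (-1) 1) (-1) = 0
  right_boundary : ∀ j < n, iteratedDerivWithin j ψ (Icc (-1) 1) 1 = 0

/-- The set of eigenvalues of the polyharmonic boundary value problem of order `2n`. -/
def polyharmonicEigenvalues (n : ℕ) : Set ℝ :=
  {μ | ∃ ψ : ℝ → ℝ, IsPolyharmonicEigenfunction n μ ψ}

/-- The minimal eigenvalue `λ_n`. -/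
def minEigenvalue (n : ℕ) : ℝ :=
  sInf (polyharmonicEigenvalues n)

/-- The hypergeometric series `₃F₂(a₁, a₂, a₃; b₁, b₂; z)`, with `(a)_k` the rising factorial.
When an upper parameter is `-m` with `m` a natural number, the series stops at `k = m`
(all later terms are zero, also those where a lower Pochhammer symbol vanishes). -/
def hypergeometric3F2 (a₁ a₂ a₃ b₁ b₂ z : ℝ) : ℝ :=
  ∑' k : ℕ,
    ((ascPochhammer ℝ k).eval a₁ * (ascPochhammer ℝ k).eval a₂ * (ascPochhammer ℝ k).eval a₃) /
      ((ascPochhammer ℝ k).eval b₁ * (ascPochhammer ℝ k).eval b₂) * (z ^ k / k.factorial)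

/-- `R_n = ₃F₂(1/2, 1, -n; 1 - 2n, n + 1; 1)`. -/
def ratioR (n : ℕ) : ℝ :=
  hypergeometric3F2 (1 / 2) 1 (-(n : ℝ)) (1 - 2 * (n : ℝ)) ((n : ℝ) + 1) 1

/-- `2 Γ(n+1) Γ(2n+1/2) / Γ(n+1/2)`. -/
def eigenUpperBound (n : ℕ) : ℝ :=
  2 * Real.Gamma ((n : ℝ) + 1) * Real.Gamma (2 * (n : ℝ) + 1 / 2) / Real.Gamma ((n : ℝ) + 1 / 2)

/-- `2 Γ(n+1) Γ(2n+1/2) / (Γ(n+1/2) R_n)`. -/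
def eigenLowerBound (n : ℕ) : ℝ :=
  2 * Real.Gamma ((n : ℝ) + 1) * Real.Gamma (2 * (n : ℝ) + 1 / 2) /
    (Real.Gamma ((n : ℝ) + 1 / 2) * ratioR n)

end

/-!
The inverse `T` of the Dirichlet problem is a compact positive integral operator on `L²(-1, 1)`, its
kernel being Boggio's Green function, so the smallest eigenvalue is `λ_n = ‖T‖⁻¹`.

For the upper bound `U_n`, insert `u = 1` into `‖T u‖² ≤ ‖T‖ ⟪T u, u⟫`: since
`T 1 = (1 - t²) ^ n / (2n)!`, both sides are Beta integrals.

For the lower bound, put `w = (1 - t²) ^ n`. The equation `T w = U_n⁻¹ ∑ₖ cₖ (1 - t²) ^ (n + k)`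
holds with `cₖ` the terms of the series `R_n`, which makes the required identities instances of
Vandermonde's convolution. As `cₖ ≥ 0`, this gives `T w ≤ (R_n / U_n) w`, strictly off `{-1, 0, 1}`,
and because the Green function is nonnegative, pairing with the absolute value of an eigenfunction
yields `1 < λ_n R_n / U_n`.

Finally `1 ≤ R_n ≤ 1 + 1 / (n + 1)`, and Wallis' product turns `U_n` into `√2 (2n)!`.
-/

noncomputable section

open MeasureTheory Polynomial
open scoped InnerProductSpace

section PositiveOperator

variable {𝕜 E : Type*} [RCLike 𝕜] [NormedAddCommGroup E] [InnerProductSpace 𝕜 E] {T : E →L[𝕜] E}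

/-- Expand `0 ≤ ⟪T y, y⟫` at `y = x - ‖T‖⁻¹ T x`. -/
lemma norm_apply_sq_le_of_isPositive (hT : T.IsPositive) (x : E) :
    ‖T x‖ ^ 2 ≤ ‖T‖ * RCLike.re (inner 𝕜 (T x) x) := by
  rcases eq_or_ne T 0 with rfl | hT0
  · simp
  have hT0' : 0 < ‖T‖ := norm_pos_iff.2 hT0
  set c : ℝ := ‖T‖⁻¹
  have hform : 0 ≤ RCLike.re (inner 𝕜 (T x) x) - 2 * c * ‖T x‖ ^ 2 +
      c ^ 2 * RCLike.re (inner 𝕜 (T (T x)) (T x)) := by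
    have hTT : inner 𝕜 (T (T x)) x = inner 𝕜 (T x) (T x) := hT.inner_left_eq_inner_right _ _
    have hnonneg := hT.re_inner_nonneg_left (x - (c : 𝕜) • T x)
    simp only [map_sub, map_smul, inner_sub_left, inner_sub_right, inner_smul_left,
      inner_smul_right, RCLike.conj_ofReal, RCLike.re_ofReal_mul, hTT,
      inner_self_eq_norm_sq (𝕜 := 𝕜)] at hnonneg
    linarith
  have hTTx : RCLike.re (inner 𝕜 (T (T x)) (T x)) ≤ ‖T‖ * ‖T x‖ ^ 2 :=
    (re_inner_le_norm _ _).trans <| by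
      rw [pow_two, ← mul_assoc]; gcongr; exact T.le_opNorm _
  have hc : c * ‖T‖ = 1 := inv_mul_cancel₀ hT0'.ne'
  have hmul : c ^ 2 * RCLike.re (inner 𝕜 (T (T x)) (T x)) ≤ c * ‖T x‖ ^ 2 :=
    calc c ^ 2 * RCLike.re (inner 𝕜 (T (T x)) (T x))
      _ ≤ c ^ 2 * (‖T‖ * ‖T x‖ ^ 2) := by gcongr
      _ = c * ‖T x‖ ^ 2 := by linear_combination (c * ‖T x‖ ^ 2) * hc
  rw [← inv_mul_le_iff₀ hT0']
  linarith

variable [CompleteSpace E]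

theorem hasEigenvalue_norm_of_isPositive (hT : T.IsPositive) (hc : IsCompactOperator T)
    (hT0 : T ≠ 0) : Module.End.HasEigenvalue (T : Module.End 𝕜 E) (‖T‖ : 𝕜) := by
  have hnorm : (‖T‖ : 𝕜) ≠ 0 := by simpa using hT0
  rw [hc.hasEigenvalue_iff_mem_spectrum hnorm]
  by_contra hres
  have : Nontrivial E := by
    obtain ⟨x, hx⟩ := DFunLike.ne_iff.1 hT0
    exact ⟨_, _, hx⟩
  obtain ⟨ε, hε, hle⟩ := T.rayleighQuotient_le_of_norm_mem_resolventSet (not_not.1 hres)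
  have hnonneg (x : E) : 0 ≤ T.rayleighQuotient x :=
    div_nonneg (hT.re_inner_nonneg_left x) (by positivity)
  have hsup : ‖T‖ ≤ ‖T‖ - ε := by
    conv_lhs => rw [T.norm_eq_iSup_rayleighQuotient hT.isSymmetric]
    exact ciSup_le fun x => (abs_of_nonneg (hnonneg x)).trans_le (hle x)
  linarith

theorem isLeast_inv_norm_of_isPositive (hT : T.IsPositive) (hc : IsCompactOperator T)
    (hT0 : T ≠ 0) : IsLeast {μ : ℝ | ∃ x ≠ 0, x = (μ : 𝕜) • T x} ‖T‖⁻¹ := by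
  have hnorm : 0 < ‖T‖ := norm_pos_iff.2 hT0
  refine ⟨?_, ?_⟩
  · obtain ⟨x, hx⟩ := (hasEigenvalue_norm_of_isPositive hT hc hT0).exists_hasEigenvector
    have hTx : T x = (‖T‖ : 𝕜) • x := hx.apply_eq_smul
    refine ⟨x, hx.2, ?_⟩
    rw [hTx, smul_smul, ← RCLike.ofReal_mul, inv_mul_cancel₀ hnorm.ne', RCLike.ofReal_one, one_smul]
  · rintro μ ⟨x, hx0, hx⟩
    have hTx : T x ≠ 0 := fun h => hx0 (by rw [hx, h, smul_zero])
    have hμ : 0 ≤ μ := by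
      have hnonneg : 0 ≤ μ * ‖T x‖ ^ 2 := by
        have := hT.re_inner_nonneg_left x
        nth_rw 2 [hx] at this
        rwa [inner_smul_right, RCLike.re_ofReal_mul, inner_self_eq_norm_sq (𝕜 := 𝕜)] at this
      exact nonneg_of_mul_nonneg_left hnonneg (by positivity)
    have hle : 1 * ‖x‖ ≤ μ * ‖T‖ * ‖x‖ :=
      calc 1 * ‖x‖ = μ * ‖T x‖ := by
            conv_lhs => rw [hx, norm_smul, RCLike.norm_of_nonneg hμ, one_mul]
        _ ≤ μ * (‖T‖ * ‖x‖) := by gcongr; exact T.le_opNorm x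
        _ = μ * ‖T‖ * ‖x‖ := by ring
    exact (inv_le_iff_one_le_mul₀ hnorm).2 (le_of_mul_le_mul_right hle (norm_pos_iff.2 hx0))

end PositiveOperator

section KernelOperator

section Compact

variable {𝕜 E K : Type*} [RCLike 𝕜] [NormedAddCommGroup E] [NormedSpace 𝕜 E]
  [TopologicalSpace K] [CompactSpace K]

/-- The operator `x ↦ (t ↦ γ t x)` of a continuous family `γ` of functionals. With `γ t` the pairing
against a kernel at `t`, it is an integral operator with continuous values. -/
def transposeCLM (γ : C(K, StrongDual 𝕜 E)) : E →L[𝕜] C(K, 𝕜) :=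
  LinearMap.mkContinuous
    { toFun x := ⟨fun t => γ t x, by fun_prop⟩
      map_add' x y := by ext t; simp
      map_smul' c x := by ext t; simp } ‖γ‖ fun x =>
    (ContinuousMap.norm_le _ (by positivity)).2 fun t =>
      (γ t).le_of_opNorm_le (γ.norm_coe_le_norm t) x

theorem isCompactOperator_transposeCLM (γ : C(K, StrongDual 𝕜 E)) :
    IsCompactOperator (transposeCLM γ) := by
  let J : C(K, 𝕜) ≃ₜ BoundedContinuousFunction K 𝕜 :=
    (ContinuousMap.linearIsometryBoundedOfCompact K 𝕜 𝕜).toHomeomorph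
  set A := transposeCLM γ '' Metric.closedBall 0 1
  have hequi : Equicontinuous ((↑) : (J '' A) → K → 𝕜) := fun t =>
    Metric.equicontinuousAt_of_continuity_modulus (fun s => ‖γ t - γ s‖)
      (by simpa using (continuous_const (y := γ t)).sub γ.continuous |>.norm.tendsto t) _ <|
      Eventually.of_forall fun s => by
        rintro ⟨_, _, ⟨x, hx, rfl⟩, rfl⟩
        rw [mem_closedBall_zero_iff] at hx
        have := (γ t - γ s).le_of_opNorm_le_of_le le_rfl hx
        rwa [mul_one, sub_apply, ← dist_eq_norm] at this
  have hbdd : ∀ (f : BoundedContinuousFunction K 𝕜) (t : K), f ∈ J '' A →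
      f t ∈ Metric.closedBall 0 ‖γ‖ := by
    rintro _ t ⟨_, ⟨x, hx, rfl⟩, rfl⟩
    rw [mem_closedBall_zero_iff] at hx ⊢
    exact ((γ t).le_of_opNorm_le_of_le (γ.norm_coe_le_norm t) hx).trans_eq (mul_one _)
  refine (isCompactOperator_iff_isCompact_closure_image_closedBall
    (transposeCLM γ).toLinearMap one_pos).2 ?_
  have := BoundedContinuousFunction.arzela_ascoli _ (isCompact_closedBall _ _) _ hbdd hequi
  rwa [← J.image_closure, J.isCompact_image] at this

end Compact

variable {X : Type*} [TopologicalSpace X] [CompactSpace X] [MeasurableSpace X] [BorelSpace X]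
  (μ : Measure X) [IsFiniteMeasure μ]

lemma inner_toLp_eq_integral (f g : C(X, ℝ)) :
    ⟪f.toLp 2 μ ℝ, g.toLp 2 μ ℝ⟫_ℝ = ∫ x, f x * g x ∂μ := by
  simp only [ContinuousMap.inner_toLp, conj_trivial, mul_comm]

/-- The integral operator `f ↦ ∫ k (·, y) f y dμ` from `L²` to continuous functions. -/
def kernelSmoothing (k : C(X × X, ℝ)) : Lp ℝ 2 μ →L[ℝ] C(X, ℝ) :=
  transposeCLM ⟨fun x => innerSL ℝ ((k.curry x).toLp 2 μ ℝ), by fun_prop⟩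

lemma kernelSmoothing_toLp (k : C(X × X, ℝ)) (f : C(X, ℝ)) (x : X) :
    kernelSmoothing μ k (f.toLp 2 μ ℝ) x = ∫ y, k (x, y) * f y ∂μ :=
  inner_toLp_eq_integral μ (k.curry x) f

/-- The integral operator with kernel `k` as an endomorphism of `L²`. -/
def kernelOperator (k : C(X × X, ℝ)) : Lp ℝ 2 μ →L[ℝ] Lp ℝ 2 μ :=
  ContinuousMap.toLp 2 μ ℝ ∘L kernelSmoothing μ k

lemma isCompactOperator_kernelOperator (k : C(X × X, ℝ)) :
    IsCompactOperator (kernelOperator μ k) :=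
  (isCompactOperator_transposeCLM
    ⟨fun x => innerSL ℝ ((k.curry x).toLp 2 μ ℝ), by fun_prop⟩).clm_comp (ContinuousMap.toLp 2 μ ℝ)

variable {μ}

lemma isPositive_of_forall_toLp [NormalSpace X] [μ.WeaklyRegular] {T : Lp ℝ 2 μ →L[ℝ] Lp ℝ 2 μ}
    (hsymm : ∀ f g : C(X, ℝ),
      ⟪T (f.toLp 2 μ ℝ), g.toLp 2 μ ℝ⟫_ℝ = ⟪f.toLp 2 μ ℝ, T (g.toLp 2 μ ℝ)⟫_ℝ)
    (hnonneg : ∀ f : C(X, ℝ), 0 ≤ ⟪T (f.toLp 2 μ ℝ), f.toLp 2 μ ℝ⟫_ℝ) : T.IsPositive := by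
  have hdense : DenseRange (ContinuousMap.toLp 2 μ ℝ : C(X, ℝ) →L[ℝ] Lp ℝ 2 μ) :=
    ContinuousMap.toLp_denseRange ℝ μ ℝ (by simp)
  refine (T.isPositive_iff).2 ⟨fun u v => ?_, fun u => ?_⟩
  · exact hdense.induction_on₂ (p := fun u v => ⟪T u, v⟫_ℝ = ⟪u, T v⟫_ℝ)
      (isClosed_eq (by fun_prop) (by fun_prop)) hsymm u v
  · exact hdense.induction_on (p := fun u => 0 ≤ ⟪T u, u⟫_ℝ) u
      (isClosed_le (by fun_prop) (by fun_prop)) hnonneg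

lemma abs_kernelSmoothing_le {k : C(X × X, ℝ)} (hk : 0 ≤ k) (f : C(X, ℝ)) (x : X) :
    |kernelSmoothing μ k (f.toLp 2 μ ℝ) x| ≤ kernelSmoothing μ k (|f|.toLp 2 μ ℝ) x := by
  simp only [kernelSmoothing_toLp, ContinuousMap.abs_apply]
  refine abs_integral_le_integral_abs.trans_eq (integral_congr_ae (.of_forall fun y => ?_))
  simp only [abs_mul, abs_of_nonneg (show 0 ≤ k (x, y) from hk (x, y))]

lemma inner_toLp_mono {f g h : C(X, ℝ)} (hfg : f ≤ g) (hh : 0 ≤ h) :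
    ⟪f.toLp 2 μ ℝ, h.toLp 2 μ ℝ⟫_ℝ ≤ ⟪g.toLp 2 μ ℝ, h.toLp 2 μ ℝ⟫_ℝ := by
  have hint (f : C(X, ℝ)) : Integrable f μ :=
    f.continuous.integrable_of_hasCompactSupport (.of_compactSpace f)
  simp only [inner_toLp_eq_integral]
  exact integral_mono (hint (f * h)) (hint (g * h))
    fun x => mul_le_mul_of_nonneg_right (hfg x) (hh x)

lemma inner_toLp_pos [μ.IsOpenPosMeasure] {f g : C(X, ℝ)} (hf : 0 ≤ f) (hg : 0 ≤ g)
    (hfg : f * g ≠ 0) : 0 < ⟪f.toLp 2 μ ℝ, g.toLp 2 μ ℝ⟫_ℝ := by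
  rw [inner_toLp_eq_integral]
  obtain ⟨x, hx⟩ := DFunLike.ne_iff.1 hfg
  exact (f * g).continuous.integral_pos_of_hasCompactSupport_nonneg_nonzero (.of_compactSpace _)
    (fun x => mul_nonneg (hf x) (hg x)) hx

/-- Pair `|f| ≤ r S |f|` with `w` and move `S` to the other side. -/
theorem one_lt_mul_of_eq_smul_kernelSmoothing [μ.IsOpenPosMeasure] {k : C(X × X, ℝ)} (hk : 0 ≤ k)
    (hsymm : (kernelOperator μ k).IsSymmetric) {f : C(X, ℝ)} (hf : f ≠ 0) {r : ℝ} (hr : 0 < r)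
    (hfr : f = r • kernelSmoothing μ k (f.toLp 2 μ ℝ)) {w : C(X, ℝ)} (hw : 0 ≤ w) {c : ℝ}
    (hle : kernelSmoothing μ k (w.toLp 2 μ ℝ) ≤ c • w)
    (hlt : Dense {x | kernelSmoothing μ k (w.toLp 2 μ ℝ) x < c * w x}) : 1 < r * c := by
  set S := kernelSmoothing μ k
  set L : C(X, ℝ) →L[ℝ] Lp ℝ 2 μ := ContinuousMap.toLp 2 μ ℝ
  have habs : |f| ≤ r • S (L |f|) := fun x => by
    have hfx : f x = r * S (L f) x := DFunLike.congr_fun hfr x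
    calc |f x| = r * |S (L f) x| := by rw [hfx, abs_mul, abs_of_pos hr]
      _ ≤ r * S (L |f|) x := by gcongr; exact abs_kernelSmoothing_le hk f x
  have hpair : ⟪L |f|, L w⟫_ℝ ≤ r * ⟪L |f|, L (S (L w))⟫_ℝ :=
    calc ⟪L |f|, L w⟫_ℝ ≤ ⟪L (r • S (L |f|)), L w⟫_ℝ := inner_toLp_mono habs hw
      _ = r * ⟪L |f|, L (S (L w))⟫_ℝ := by
        rw [map_smul, real_inner_smul_left]
        exact congrArg (r * ·) (hsymm (L |f|) (L w))
  have hne : |f| * (c • w - S (L w)) ≠ 0 := fun hzero => hf <| by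
    refine DFunLike.coe_injective (Continuous.ext_on hlt f.continuous continuous_const ?_)
    intro x hx
    have hx0 : |f x| * (c * w x - S (L w) x) = 0 := DFunLike.congr_fun hzero x
    exact abs_eq_zero.1 ((mul_eq_zero.1 hx0).resolve_right (sub_pos.2 hx).ne')
  have hstrict : ⟪L |f|, L (S (L w))⟫_ℝ < c * ⟪L |f|, L w⟫_ℝ := by
    have := inner_toLp_pos (μ := μ) (abs_nonneg f) (sub_nonneg.2 hle) hne
    rwa [map_sub, map_smul, inner_sub_right, real_inner_smul_right, sub_pos] at this
  have hnonneg : 0 ≤ ⟪L |f|, L w⟫_ℝ := by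
    simpa using inner_toLp_mono (μ := μ) (abs_nonneg f) hw
  by_contra hrc
  have : r * ⟪L |f|, L (S (L w))⟫_ℝ < ⟪L |f|, L w⟫_ℝ :=
    calc r * ⟪L |f|, L (S (L w))⟫_ℝ < r * (c * ⟪L |f|, L w⟫_ℝ) := by gcongr
      _ = (r * c) * ⟪L |f|, L w⟫_ℝ := by ring
      _ ≤ ⟪L |f|, L w⟫_ℝ := mul_le_of_le_one_left hnonneg (not_lt.1 hrc)
  exact absurd hpair this.not_ge

lemma exists_eq_smul_kernelOperator_iff [μ.IsOpenPosMeasure] {k : C(X × X, ℝ)} {c : ℝ} :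
    (∃ u ≠ 0, u = c • kernelOperator μ k u) ↔
      ∃ f : C(X, ℝ), f ≠ 0 ∧ f = c • kernelSmoothing μ k (f.toLp 2 μ ℝ) := by
  constructor
  · rintro ⟨u, hu0, hu⟩
    have hLf : (c • kernelSmoothing μ k u).toLp 2 μ ℝ = u := by
      rw [map_smul]
      exact hu.symm
    refine ⟨c • kernelSmoothing μ k u, fun hzero => hu0 ?_, by rw [hLf]⟩
    rw [← hLf, hzero, map_zero]
  · rintro ⟨f, hf0, hf⟩
    refine ⟨f.toLp 2 μ ℝ, (map_ne_zero_iff _ (ContinuousMap.toLp_injective μ)).2 hf0, ?_⟩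
    conv_lhs => rw [hf, map_smul]
    rfl

end KernelOperator

section DerivativeChains

/-- `φ 0, φ 1, …, φ N` are successive derivatives within `s`, the last one continuous on `s`.
Only the values on `s` matter, which makes polynomials and `iteratedDerivWithin` equally usable. -/
structure IsDerivChain (s : Set ℝ) (N : ℕ) (φ : ℕ → ℝ → ℝ) : Prop where
  hasDerivWithinAt : ∀ j < N, ∀ t ∈ s, HasDerivWithinAt (φ j) (φ (j + 1) t) s t
  continuousOn_last : ContinuousOn (φ N) s

/-- The bilinear concomitant `q φ⁽ᴺ⁻¹⁾ - q' φ⁽ᴺ⁻²⁾ + ⋯ ± q⁽ᴺ⁻¹⁾ φ` of two derivative chains, the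
boundary term of `N`-fold integration by parts. -/
def concomitant (N : ℕ) (q φ : ℕ → ℝ → ℝ) (t : ℝ) : ℝ :=
  ∑ j ∈ Finset.range N, (-1) ^ j * (q j t * φ (N - 1 - j) t)

namespace IsDerivChain

variable {s : Set ℝ} {N : ℕ} {φ q : ℕ → ℝ → ℝ}

lemma continuousOn (h : IsDerivChain s N φ) {j : ℕ} (hj : j ≤ N) : ContinuousOn (φ j) s := by
  rcases hj.lt_or_eq with hj | rfl
  · exact fun t ht => (h.hasDerivWithinAt j hj t ht).continuousWithinAt
  · exact h.continuousOn_last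

lemma mono {t : Set ℝ} (h : IsDerivChain s N φ) (hts : t ⊆ s) : IsDerivChain t N φ :=
  ⟨fun j hj x hx => (h.hasDerivWithinAt j hj x (hts hx)).mono hts, h.continuousOn_last.mono hts⟩

lemma of_le {m : ℕ} (h : IsDerivChain s N φ) (hm : m ≤ N) : IsDerivChain s m φ :=
  ⟨fun j hj => h.hasDerivWithinAt j (hj.trans_le hm), h.continuousOn hm⟩

lemma shift {m : ℕ} (h : IsDerivChain s (m + N) φ) : IsDerivChain s N fun j => φ (m + j) :=
  ⟨fun j hj => h.hasDerivWithinAt (m + j) (by omega), h.continuousOn_last⟩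

lemma sub (hq : IsDerivChain s N q) (hφ : IsDerivChain s N φ) :
    IsDerivChain s N fun j t => q j t - φ j t :=
  ⟨fun j hj t ht => (hq.hasDerivWithinAt j hj t ht).sub (hφ.hasDerivWithinAt j hj t ht),
    hq.continuousOn_last.sub hφ.continuousOn_last⟩

lemma of_polynomial (s : Set ℝ) (N : ℕ) (P : ℝ[X]) :
    IsDerivChain s N fun j t => (derivative^[j] P).eval t := by
  refine ⟨fun j _ t _ => ?_, (Polynomial.continuous _).continuousOn⟩
  rw [Function.iterate_succ_apply']
  exact (Polynomial.hasDerivAt _ t).hasDerivWithinAt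

lemma of_contDiffOn (hs : UniqueDiffOn ℝ s) {ψ : ℝ → ℝ} (h : ContDiffOn ℝ N ψ s) :
    IsDerivChain s N fun j => iteratedDerivWithin j ψ s := by
  refine ⟨fun j hj t ht => ?_, h.continuousOn_iteratedDerivWithin le_rfl hs⟩
  rw [iteratedDerivWithin_succ]
  exact (h.differentiableOn_iteratedDerivWithin (by exact_mod_cast hj) hs t ht).hasDerivWithinAt

lemma iteratedDerivWithin_eq (hs : UniqueDiffOn ℝ s) (h : IsDerivChain s N φ) {j : ℕ}
    (hj : j ≤ N) : EqOn (iteratedDerivWithin j (φ 0) s) (φ j) s := by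
  induction j with
  | zero => intro t _; simp
  | succ j ih =>
    intro t ht
    rw [iteratedDerivWithin_succ, derivWithin_congr (ih (by omega)) (ih (by omega) ht)]
    exact (h.hasDerivWithinAt j (by omega) t ht).derivWithin (hs t ht)

lemma contDiffOn (hs : UniqueDiffOn ℝ s) (h : IsDerivChain s N φ) : ContDiffOn ℝ N (φ 0) s := by
  refine contDiffOn_of_continuousOn_differentiableOn_deriv (fun m hm => ?_) fun m hm => ?_
  · have hm' : m ≤ N := by exact_mod_cast hm
    exact (h.continuousOn hm').congr (h.iteratedDerivWithin_eq hs hm')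
  · have hm' : m < N := by exact_mod_cast hm
    exact DifferentiableOn.congr
      (fun t ht => (h.hasDerivWithinAt m hm' t ht).differentiableWithinAt)
      (h.iteratedDerivWithin_eq hs hm'.le)

lemma hasDerivWithinAt_concomitant (hq : IsDerivChain s N q) (hφ : IsDerivChain s N φ) {t : ℝ}
    (ht : t ∈ s) :
    HasDerivWithinAt (concomitant N q φ) (q 0 t * φ N t - (-1) ^ N * (q N t * φ 0 t)) s t := by
  have hsum : HasDerivWithinAt (concomitant N q φ)
      (∑ j ∈ Finset.range N, (-1) ^ j * (q (j + 1) t * φ (N - 1 - j) t +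
        q j t * φ (N - 1 - j + 1) t)) s t :=
    HasDerivWithinAt.fun_sum fun j hj => by
      have hjN := Finset.mem_range.1 hj
      exact ((hq.hasDerivWithinAt j hjN t ht).mul
        (hφ.hasDerivWithinAt _ (by omega) t ht)).const_mul _
  have htelescope := Finset.sum_range_sub' (fun j => (-1 : ℝ) ^ j * (q j t * φ (N - j) t)) N
  simp only [pow_zero, one_mul, Nat.sub_zero, Nat.sub_self] at htelescope
  convert hsum using 1
  rw [← htelescope]
  refine Finset.sum_congr rfl fun j hj => ?_
  have hjN := Finset.mem_range.1 hj
  rw [show N - (j + 1) = N - 1 - j by omega, show N - j = N - 1 - j + 1 by omega, pow_succ]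
  ring

variable {a b : ℝ}

theorem integral_sub_eq_concomitant_sub (hab : a ≤ b) (hq : IsDerivChain (Icc a b) N q)
    (hφ : IsDerivChain (Icc a b) N φ) :
    ∫ t in a..b, (q 0 t * φ N t - (-1) ^ N * (q N t * φ 0 t)) =
      concomitant N q φ b - concomitant N q φ a := by
  refine intervalIntegral.integral_eq_sub_of_hasDerivAt_of_le hab
    (fun t ht => (hasDerivWithinAt_concomitant hq hφ ht).continuousWithinAt) (fun t ht => ?_) ?_
  · exact (hasDerivWithinAt_concomitant hq hφ (Ioo_subset_Icc_self ht)).hasDerivAt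
      (Icc_mem_nhds ht.1 ht.2)
  · refine ContinuousOn.intervalIntegrable_of_Icc hab ?_
    exact ((hq.continuousOn (Nat.zero_le _)).mul (hφ.continuousOn le_rfl)).sub
      (continuousOn_const.mul ((hq.continuousOn le_rfl).mul (hφ.continuousOn (Nat.zero_le _))))

lemma integral_eval_mul_eq_concomitant_sub (hab : a ≤ b) (hφ : IsDerivChain (Icc a b) N φ)
    {p : ℝ[X]} (hp : p.degree < N) :
    ∫ t in a..b, p.eval t * φ N t =
      concomitant N (fun j t => (derivative^[j] p).eval t) φ b -
        concomitant N (fun j t => (derivative^[j] p).eval t) φ a := by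
  rw [← (of_polynomial (Icc a b) N p).integral_sub_eq_concomitant_sub hab hφ]
  simp [iterate_derivative_eq_zero_of_degree_lt hp]

end IsDerivChain

lemma concomitant_eval_sub_eval {p q : ℝ[X]} {c t : ℝ} {N : ℕ}
    (hpq : p - q = C c * (X - C t) ^ N) (φ : ℕ → ℝ → ℝ) :
    concomitant (N + 1) (fun j t => (derivative^[j] p).eval t) φ t -
        concomitant (N + 1) (fun j t => (derivative^[j] q).eval t) φ t =
      (-1) ^ N * N.factorial * c * φ 0 t := by
  have hjump (j : ℕ) : (derivative^[j] p).eval t - (derivative^[j] q).eval t =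
      c * (derivative^[j] ((X - C t) ^ N)).eval t := by
    rw [← eval_sub, ← iterate_derivative_sub, hpq, iterate_derivative_C_mul, eval_C_mul]
  simp only [concomitant, ← Finset.sum_sub_distrib, ← mul_sub, ← sub_mul, hjump]
  rw [Finset.sum_range_succ, Finset.sum_eq_zero, iterate_derivative_X_sub_pow_self]
  · simp
    ring
  · intro j hj
    have hjN := Finset.mem_range.1 hj
    rw [iterate_derivative_X_sub_pow]
    simp [Nat.sub_ne_zero_of_lt hjN]

/-- The boundary terms at `a` and `b` vanish and the jump of the kernel at `t` produces `φ 0 t`. -/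
theorem integral_add_integral_eq_of_sub_eq {a b t : ℝ} (ht : t ∈ Icc a b) {N : ℕ}
    {φ : ℕ → ℝ → ℝ} (hφ : IsDerivChain (Icc a b) (N + 1) φ) {p q : ℝ[X]} {c : ℝ}
    (hp : p.degree < (N + 1 : ℕ)) (hq : q.degree < (N + 1 : ℕ))
    (hpq : p - q = C c * (X - C t) ^ N)
    (hpa : concomitant (N + 1) (fun j t => (derivative^[j] p).eval t) φ a = 0)
    (hqb : concomitant (N + 1) (fun j t => (derivative^[j] q).eval t) φ b = 0) :
    (∫ s in a..t, p.eval s * φ (N + 1) s) + (∫ s in t..b, q.eval s * φ (N + 1) s) =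
      (-1) ^ N * N.factorial * c * φ 0 t := by
  rw [(hφ.mono (Icc_subset_Icc_right ht.2)).integral_eval_mul_eq_concomitant_sub ht.1 hp,
    (hφ.mono (Icc_subset_Icc_left ht.1)).integral_eval_mul_eq_concomitant_sub ht.2 hq,
    hpa, hqb, sub_zero, zero_sub, ← sub_eq_add_neg, concomitant_eval_sub_eval hpq]

/-- A chain of `2n` derivatives on `[a, b]` satisfying the Dirichlet conditions of order `n`. -/
structure IsDirichletChain (a b : ℝ) (n : ℕ) (φ : ℕ → ℝ → ℝ) : Prop
    extends IsDerivChain (Icc a b) (2 * n) φ where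
  left : ∀ j < n, φ j a = 0
  right : ∀ j < n, φ j b = 0

lemma concomitant_two_mul_eq_zero {n : ℕ} {q φ : ℕ → ℝ → ℝ} {t : ℝ} (hq : ∀ j < n, q j t = 0)
    (hφ : ∀ j < n, φ j t = 0) : concomitant (2 * n) q φ t = 0 := by
  refine Finset.sum_eq_zero fun j hj => ?_
  have hj' := Finset.mem_range.1 hj
  rcases lt_or_ge j n with hjn | hjn
  · rw [hq j hjn, zero_mul, mul_zero]
  · rw [hφ (2 * n - 1 - j) (by omega), mul_zero, mul_zero]

theorem IsDirichletChain.integral_mul_last {a b : ℝ} (hab : a ≤ b) {n : ℕ} {φ χ : ℕ → ℝ → ℝ}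
    (hφ : IsDirichletChain a b n φ) (hχ : IsDirichletChain a b n χ) :
    ∫ t in a..b, φ 0 t * ((-1) ^ n * χ (2 * n) t) = ∫ t in a..b, φ n t * χ n t := by
  have hparts := (hφ.of_le (by omega : n ≤ 2 * n)).integral_sub_eq_concomitant_sub hab
    (IsDerivChain.shift (m := n) (by rw [← two_mul]; exact hχ.toIsDerivChain))
  have hbdry {t : ℝ} (h : ∀ j < n, φ j t = 0) : concomitant n φ (fun j => χ (n + j)) t = 0 :=
    Finset.sum_eq_zero fun j hj => by rw [h j (Finset.mem_range.1 hj), zero_mul, mul_zero]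
  rw [hbdry hφ.left, hbdry hφ.right, sub_zero] at hparts
  have hint {j k : ℕ} (hj : j ≤ 2 * n) (hk : k ≤ 2 * n) :
      IntervalIntegrable (fun t => φ j t * χ k t) volume a b :=
    ((hφ.continuousOn hj).mul (hχ.continuousOn hk)).intervalIntegrable_of_Icc hab
  simp only [add_zero, ← two_mul] at hparts
  rw [intervalIntegral.integral_sub (hint (by omega) le_rfl)
    ((hint (by omega) (by omega)).const_mul _), intervalIntegral.integral_const_mul,
    sub_eq_zero] at hparts
  simp only [mul_left_comm _ ((-1 : ℝ) ^ n), intervalIntegral.integral_const_mul, hparts]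
  rw [← mul_assoc, ← mul_pow, neg_one_mul, neg_neg, one_pow, one_mul]

end DerivativeChains

section Hermite

lemma X_sub_C_pow_dvd_iff_forall_eval_iterate_derivative {P : ℝ[X]} {x : ℝ} {n : ℕ} :
    (X - C x) ^ n ∣ P ↔ ∀ j < n, (derivative^[j] P).eval x = 0 := by
  rcases eq_or_ne P 0 with rfl | hP
  · simp
  cases n with
  | zero => simp
  | succ n =>
    rw [← le_rootMultiplicity_iff hP, Nat.succ_le_iff,
      lt_rootMultiplicity_iff_isRoot_iterate_derivative hP]
    simp only [Nat.lt_succ_iff, IsRoot.def]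

/-- The linear system is square, and its kernel is trivial since `(X - a)ⁿ (X - b)ⁿ` divides only
the zero polynomial of degree below `2n`. -/
theorem exists_hermite_interpolant {a b : ℝ} (hab : a ≠ b) (n : ℕ) (u v : ℕ → ℝ) :
    ∃ P : ℝ[X], P.degree < (2 * n : ℕ) ∧ ∀ j < n,
      (derivative^[j] P).eval a = u j ∧ (derivative^[j] P).eval b = v j := by
  let jet (x : ℝ) : ℝ[X] →ₗ[ℝ] (Fin n → ℝ) :=
    LinearMap.pi fun j => leval x ∘ₗ derivative ^ (j : ℕ)
  have jet_apply (x P) {j : ℕ} (hj : j < n) : jet x P ⟨j, hj⟩ = (derivative^[j] P).eval x := by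
    simp [jet, leval, Module.End.pow_apply]
  let jets : degreeLT ℝ (2 * n) →ₗ[ℝ] (Fin n → ℝ) × (Fin n → ℝ) :=
    (jet a).prod (jet b) ∘ₗ (degreeLT ℝ (2 * n)).subtype
  have : FiniteDimensional ℝ (degreeLT ℝ (2 * n)) :=
    Module.Finite.equiv (degreeLTEquiv ℝ (2 * n)).symm
  have hfinrank : Module.finrank ℝ (degreeLT ℝ (2 * n)) =
      Module.finrank ℝ ((Fin n → ℝ) × (Fin n → ℝ)) := by
    rw [(degreeLTEquiv ℝ (2 * n)).finrank_eq]
    simp [two_mul]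
  have hdvd {x : ℝ} {P : ℝ[X]} (hP : jet x P = 0) : (X - C x) ^ n ∣ P :=
    X_sub_C_pow_dvd_iff_forall_eval_iterate_derivative.2 fun j hj => by
      rw [← jet_apply x P hj, hP, Pi.zero_apply]
  have hinj : Function.Injective jets := by
    rw [← LinearMap.ker_eq_bot, LinearMap.ker_eq_bot']
    rintro ⟨P, hPdeg⟩ hP
    have hcoprime : IsCoprime ((X - C a) ^ n) ((X - C b) ^ n) :=
      (isCoprime_X_sub_C_of_isUnit_sub (sub_ne_zero.2 hab).isUnit).pow
    have hprod := hcoprime.mul_dvd (hdvd (congrArg Prod.fst hP)) (hdvd (congrArg Prod.snd hP))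
    refine Subtype.ext (eq_zero_of_dvd_of_degree_lt hprod ((mem_degreeLT.1 hPdeg).trans_le ?_))
    rw [degree_mul, degree_pow, degree_pow, degree_X_sub_C, degree_X_sub_C, nsmul_one]
    exact_mod_cast (two_mul n).le
  obtain ⟨P, hP⟩ := (LinearMap.injective_iff_surjective_of_finrank_eq_finrank hfinrank).1 hinj
    (fun j => u j, fun j => v j)
  refine ⟨P, mem_degreeLT.1 P.2, fun j hj => ⟨?_, ?_⟩⟩
  · rw [← jet_apply a P hj]; exact congrFun (congrArg Prod.fst hP) ⟨j, hj⟩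
  · rw [← jet_apply b P hj]; exact congrFun (congrArg Prod.snd hP) ⟨j, hj⟩

/-- The `m`-fold primitive of `f` whose successive primitives all vanish at `0`. -/
def iteratedPrimitive (f : ℝ → ℝ) : ℕ → ℝ → ℝ
  | 0 => f
  | m + 1 => fun x => ∫ s in (0 : ℝ)..x, iteratedPrimitive f m s

lemma continuous_iteratedPrimitive {f : ℝ → ℝ} (hf : Continuous f) :
    ∀ m, Continuous (iteratedPrimitive f m)
  | 0 => hf
  | m + 1 => intervalIntegral.continuous_primitive
      (fun _ _ => (continuous_iteratedPrimitive hf m).intervalIntegrable _ _) 0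

lemma hasDerivAt_iteratedPrimitive {f : ℝ → ℝ} (hf : Continuous f) (m : ℕ) (x : ℝ) :
    HasDerivAt (iteratedPrimitive f (m + 1)) (iteratedPrimitive f m x) x :=
  (continuous_iteratedPrimitive hf m).integral_hasStrictDerivAt 0 x |>.hasDerivAt

lemma isDerivChain_iteratedPrimitive {f : ℝ → ℝ} (hf : Continuous f) (s : Set ℝ) (N : ℕ) :
    IsDerivChain s N fun j => iteratedPrimitive f (N - j) := by
  refine ⟨fun j hj t _ => ?_, (continuous_iteratedPrimitive hf _).continuousOn⟩
  have hderiv := hasDerivAt_iteratedPrimitive hf (N - (j + 1)) t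
  rw [show N - (j + 1) + 1 = N - j by omega] at hderiv
  exact hderiv.hasDerivWithinAt

theorem exists_isDirichletChain {a b : ℝ} (hab : a ≠ b) (n : ℕ) {f : ℝ → ℝ} (hf : Continuous f) :
    ∃ φ, IsDirichletChain a b n φ ∧ φ (2 * n) = f := by
  obtain ⟨P, hPdeg, hP⟩ := exists_hermite_interpolant hab n
    (fun j => iteratedPrimitive f (2 * n - j) a) (fun j => iteratedPrimitive f (2 * n - j) b)
  refine ⟨fun j t => iteratedPrimitive f (2 * n - j) t - (derivative^[j] P).eval t,
    ⟨(isDerivChain_iteratedPrimitive hf _ _).sub (.of_polynomial _ _ P),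
      fun j hj => sub_eq_zero.2 (hP j hj).1.symm, fun j hj => sub_eq_zero.2 (hP j hj).2.symm⟩, ?_⟩
  funext t
  simp [iterate_derivative_eq_zero_of_degree_lt hPdeg, iteratedPrimitive]

end Hermite

section BoggioGreenFunction

theorem integral_sub_pow_mul_sub_pow (α β : ℝ) (a b : ℕ) :
    ∫ x in α..β, (x - α) ^ a * (β - x) ^ b =
      (β - α) ^ (a + b + 1) * (a.factorial * b.factorial / (a + b + 1).factorial) := by
  induction b generalizing a with
  | zero =>
    simp [intervalIntegral.integral_comp_sub_right (fun x => x ^ a), Nat.factorial_succ]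
    field_simp
  | succ b ih =>
    have hsplit (x : ℝ) : (x - α) ^ a * (β - x) ^ (b + 1) =
        (β - α) * ((x - α) ^ a * (β - x) ^ b) - (x - α) ^ (a + 1) * (β - x) ^ b := by ring
    simp only [hsplit]
    rw [intervalIntegral.integral_sub (Continuous.intervalIntegrable (by fun_prop) _ _)
      (Continuous.intervalIntegrable (by fun_prop) _ _), intervalIntegral.integral_const_mul, ih,
      ih, show a + 1 + b + 1 = (a + b + 1) + 1 by ring,
      show a + (b + 1) + 1 = (a + b + 1) + 1 by ring]
    simp only [Nat.factorial_succ]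
    push_cast
    field_simp
    ring

lemma integral_one_sub_sq_pow (m : ℕ) :
    ∫ x in (-1 : ℝ)..1, (1 - x ^ 2) ^ m =
      2 ^ (2 * m + 1) * (m.factorial : ℝ) ^ 2 / (2 * m + 1).factorial := by
  have hfactor (x : ℝ) : (1 - x ^ 2) ^ m = (x - -1) ^ m * (1 - x) ^ m := by
    rw [← mul_pow]; ring
  simp only [hfactor, integral_sub_pow_mul_sub_pow, ← two_mul]
  norm_num
  ring

/-- The polynomial `(2 ^ (2m+1) m!²)⁻¹ ∫₀ᵉ x ^ m (2d + x) ^ m dx` in `d` and `e`, with arguments in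
an arbitrary real algebra so that both numbers and polynomials can be substituted. -/
def boggioProfile {A : Type*} [CommRing A] [Algebra ℝ A] (m : ℕ) (d e : A) : A :=
  ∑ j ∈ Finset.range (m + 1),
    algebraMap ℝ A ((m.choose j : ℝ) * 2 ^ j / (2 * m + 1 - j : ℕ) /
      (2 ^ (2 * m + 1) * (m.factorial : ℝ) ^ 2)) * (d ^ j * e ^ (2 * m + 1 - j))

lemma map_boggioProfile {A B : Type*} [CommRing A] [Algebra ℝ A] [CommRing B] [Algebra ℝ B]
    (f : A →ₐ[ℝ] B) (m : ℕ) (d e : A) : f (boggioProfile m d e) = boggioProfile m (f d) (f e) := by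
  simp only [boggioProfile, map_sum, map_mul, map_pow, AlgHom.commutes]

lemma boggioProfile_nonneg (m : ℕ) {d e : ℝ} (hd : 0 ≤ d) (he : 0 ≤ e) :
    0 ≤ boggioProfile m d e :=
  Finset.sum_nonneg fun j _ => by
    rw [Algebra.algebraMap_self, RingHom.id_apply]
    positivity

lemma boggioProfile_eq_integral (m : ℕ) (d e : ℝ) :
    boggioProfile m d e =
      (∫ x in (0 : ℝ)..e, x ^ m * (2 * d + x) ^ m) / (2 ^ (2 * m + 1) * (m.factorial : ℝ) ^ 2) := by
  have hexpand (x : ℝ) : x ^ m * (2 * d + x) ^ m =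
      ∑ j ∈ Finset.range (m + 1), (m.choose j : ℝ) * (2 * d) ^ j * x ^ (2 * m - j) := by
    rw [add_pow, Finset.mul_sum]
    refine Finset.sum_congr rfl fun j hj => ?_
    rw [show 2 * m - j = m + (m - j) by grind, pow_add]
    ring
  simp only [hexpand]
  rw [intervalIntegral.integral_finsetSum
    fun j _ => Continuous.intervalIntegrable (by fun_prop) _ _, Finset.sum_div]
  refine Finset.sum_congr rfl fun j hj => ?_
  rw [intervalIntegral.integral_const_mul, integral_pow,
    show 2 * m + 1 - j = (2 * m - j) + 1 by grind]
  simp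
  ring

lemma boggioProfile_sub_boggioProfile (m : ℕ) (d e : ℝ) :
    boggioProfile m d e - boggioProfile m (-d) (e + 2 * d) =
      (-1) ^ (m + 1) * d ^ (2 * m + 1) / (2 * m + 1).factorial := by
  have htranslate : ∫ x in (0 : ℝ)..(e + 2 * d), x ^ m * (2 * -d + x) ^ m =
      ∫ x in -(2 * d)..e, x ^ m * (2 * d + x) ^ m := by
    rw [← neg_add_cancel (2 * d), ← intervalIntegral.integral_comp_add_right]
    congr! 2 with x
    rw [← mul_pow, ← mul_pow]
    ring
  have hbeta : ∫ x in -(2 * d)..0, x ^ m * (2 * d + x) ^ m =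
      (-1) ^ m * ((2 * d) ^ (2 * m + 1) *
        ((m.factorial : ℝ) * m.factorial / (2 * m + 1).factorial)) := by
    have hsign (x : ℝ) : x ^ m * (2 * d + x) ^ m =
        (-1) ^ m * ((x - -(2 * d)) ^ m * (0 - x) ^ m) := by
      rw [← mul_pow, ← mul_pow, ← mul_pow]; ring
    simp only [hsign, intervalIntegral.integral_const_mul, integral_sub_pow_mul_sub_pow, ← two_mul]
    ring
  have hint (a b : ℝ) : IntervalIntegrable (fun x => x ^ m * (2 * d + x) ^ m) volume a b :=
    Continuous.intervalIntegrable (by fun_prop) _ _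
  rw [boggioProfile_eq_integral, boggioProfile_eq_integral, htranslate, ← sub_div,
    ← intervalIntegral.integral_add_adjacent_intervals (hint (-(2 * d)) 0) (hint 0 e),
    sub_add_cancel_right, hbeta]
  field_simp
  ring

lemma degree_boggioProfile_lt (m : ℕ) {d e : ℝ[X]} (hd : d.natDegree ≤ 1) (he : e.natDegree ≤ 1) :
    (boggioProfile m d e).degree < (2 * m + 1 + 1 : ℕ) := by
  refine (degree_le_of_natDegree_le <| natDegree_sum_le_of_forall_le _ _ fun j hj => ?_).trans_lt
    (by exact_mod_cast Nat.lt_succ_self (2 * m + 1))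
  refine (natDegree_C_mul_le _ _).trans (natDegree_mul_le.trans ?_)
  have hdj := natDegree_pow_le_of_le j hd
  have hej := natDegree_pow_le_of_le (2 * m + 1 - j) he
  grind

lemma pow_dvd_boggioProfile (m : ℕ) (d : ℝ[X]) {e f : ℝ[X]} (hfe : f ∣ e) :
    f ^ (m + 1) ∣ boggioProfile m d e :=
  Finset.dvd_sum fun j hj => dvd_mul_of_dvd_right (dvd_mul_of_dvd_right
    ((pow_dvd_pow f (by grind)).trans (pow_dvd_pow_of_dvd hfe _)) _) _

/-- Boggio's Green function of `(-1) ^ (m+1) D ^ (2m+2)` on `[-1, 1]` with Dirichlet boundary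
conditions. Substituting `x = |t - s| (v - 1)` in the profile turns it into the usual
`|t - s| ^ (2m+1) ∫ (v² - 1) ^ m dv` over `1 ≤ v ≤ (1 - t s) / |t - s|`, up to the constant. -/
def green (m : ℕ) (t s : ℝ) : ℝ :=
  boggioProfile m |t - s| (1 - t * s - |t - s|)

lemma continuous_green (m : ℕ) : Continuous fun x : ℝ × ℝ => green m x.1 x.2 := by
  simp only [green, boggioProfile, Algebra.algebraMap_self, RingHom.id_apply]
  fun_prop

lemma green_nonneg (m : ℕ) {t s : ℝ} (ht : t ∈ Icc (-1 : ℝ) 1) (hs : s ∈ Icc (-1 : ℝ) 1) :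
    0 ≤ green m t s := by
  refine boggioProfile_nonneg m (abs_nonneg _) ?_
  obtain ⟨ht1, ht2⟩ := ht
  obtain ⟨hs1, hs2⟩ := hs
  rcases abs_cases (t - s) with ⟨h, -⟩ | ⟨h, -⟩ <;> rw [h] <;> nlinarith

/-- The polynomial to which `green m t` restricts on `[-1, t]`. -/
def greenLeft (m : ℕ) (t : ℝ) : ℝ[X] :=
  boggioProfile m (C t - X) (C (1 - t) * (X + 1))

/-- The polynomial to which `green m t` restricts on `[t, 1]`. -/
def greenRight (m : ℕ) (t : ℝ) : ℝ[X] :=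
  boggioProfile m (X - C t) (C (1 + t) * (1 - X))

lemma eval_boggioProfile (m : ℕ) (d e : ℝ[X]) (s : ℝ) :
    (boggioProfile m d e).eval s = boggioProfile m (d.eval s) (e.eval s) := by
  simpa only [coe_aeval_eq_eval] using map_boggioProfile (aeval s) m d e

lemma eval_greenLeft (m : ℕ) (t s : ℝ) :
    (greenLeft m t).eval s = boggioProfile m (t - s) ((1 - t) * (s + 1)) := by
  simp [greenLeft, eval_boggioProfile]

lemma eval_greenRight (m : ℕ) (t s : ℝ) :
    (greenRight m t).eval s = boggioProfile m (s - t) ((1 + t) * (1 - s)) := by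
  simp [greenRight, eval_boggioProfile]

lemma green_eq_eval_greenLeft (m : ℕ) {t s : ℝ} (h : s ≤ t) :
    green m t s = (greenLeft m t).eval s := by
  rw [green, eval_greenLeft, abs_of_nonneg (sub_nonneg.2 h)]
  ring_nf

lemma green_eq_eval_greenRight (m : ℕ) {t s : ℝ} (h : t ≤ s) :
    green m t s = (greenRight m t).eval s := by
  rw [green, eval_greenRight, abs_of_nonpos (sub_nonpos.2 h)]
  ring_nf

lemma greenLeft_sub_greenRight (m : ℕ) (t : ℝ) :
    greenLeft m t - greenRight m t =
      C ((-1) ^ m / ((2 * m + 1).factorial : ℝ)) * (X - C t) ^ (2 * m + 1) := by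
  refine Polynomial.funext fun s => ?_
  have hjump := boggioProfile_sub_boggioProfile m (t - s) ((1 - t) * (s + 1))
  rw [neg_sub, show (1 - t) * (s + 1) + 2 * (t - s) = (1 + t) * (1 - s) by ring] at hjump
  rw [eval_sub, eval_greenLeft, eval_greenRight, hjump, ← neg_sub s t,
    (odd_two_mul_add_one m).neg_pow]
  simp only [eval_mul, eval_C, eval_pow, eval_sub, eval_X]
  ring

lemma eval_iterate_derivative_greenLeft (m : ℕ) (t : ℝ) :
    ∀ j < m + 1, (derivative^[j] (greenLeft m t)).eval (-1) = 0 :=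
  X_sub_C_pow_dvd_iff_forall_eval_iterate_derivative.1 <|
    pow_dvd_boggioProfile m _ <| (Eq.dvd (by simp)).trans (dvd_mul_left (X + 1) _)

lemma eval_iterate_derivative_greenRight (m : ℕ) (t : ℝ) :
    ∀ j < m + 1, (derivative^[j] (greenRight m t)).eval 1 = 0 :=
  X_sub_C_pow_dvd_iff_forall_eval_iterate_derivative.1 <|
    pow_dvd_boggioProfile m _ <| (dvd_sub_comm.1 (by simp)).trans (dvd_mul_left (1 - X) _)

lemma integral_greenLeft_add_integral_greenRight {m : ℕ} {φ : ℕ → ℝ → ℝ}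
    (h : IsDirichletChain (-1) 1 (m + 1) φ) {t : ℝ} (ht : t ∈ Icc (-1 : ℝ) 1) :
    (∫ s in (-1 : ℝ)..t, (greenLeft m t).eval s * φ (2 * (m + 1)) s) +
      (∫ s in t..1, (greenRight m t).eval s * φ (2 * (m + 1)) s) = (-1) ^ (m + 1) * φ 0 t := by
  have hrep := integral_add_integral_eq_of_sub_eq ht (N := 2 * m + 1) h.toIsDerivChain
    (degree_boggioProfile_lt m (by compute_degree) (by compute_degree))
    (degree_boggioProfile_lt m (by compute_degree) (by compute_degree))
    (greenLeft_sub_greenRight m t)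
    (concomitant_two_mul_eq_zero (eval_iterate_derivative_greenLeft m t) h.left)
    (concomitant_two_mul_eq_zero (eval_iterate_derivative_greenRight m t) h.right)
  refine hrep.trans ?_
  rw [(odd_two_mul_add_one m).neg_one_pow]
  field_simp
  ring

theorem integral_green_mul {m : ℕ} {φ : ℕ → ℝ → ℝ} (h : IsDirichletChain (-1) 1 (m + 1) φ)
    {t : ℝ} (ht : t ∈ Icc (-1 : ℝ) 1) :
    ∫ s in (-1 : ℝ)..1, green m t s * ((-1) ^ (m + 1) * φ (2 * (m + 1)) s) = φ 0 t := by
  set f := φ (2 * (m + 1))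
  have hleft : ∫ s in (-1 : ℝ)..t, green m t s * f s =
      ∫ s in (-1 : ℝ)..t, (greenLeft m t).eval s * f s :=
    intervalIntegral.integral_congr fun s hs => by
      rw [uIcc_of_le ht.1] at hs
      simp only [green_eq_eval_greenLeft m hs.2]
  have hright : ∫ s in t..1, green m t s * f s = ∫ s in t..1, (greenRight m t).eval s * f s :=
    intervalIntegral.integral_congr fun s hs => by
      rw [uIcc_of_le ht.2] at hs
      simp only [green_eq_eval_greenRight m hs.1]
  have hcont : ContinuousOn (fun s => green m t s * f s) (Icc (-1) 1) :=
    ((continuous_green m).comp (Continuous.prodMk_right t)).continuousOn.mul h.continuousOn_last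
  have hsplit := intervalIntegral.integral_add_adjacent_intervals (μ := volume)
    ((hcont.mono (Icc_subset_Icc_right ht.2)).intervalIntegrable_of_Icc ht.1)
    ((hcont.mono (Icc_subset_Icc_left ht.1)).intervalIntegrable_of_Icc ht.2)
  simp only [mul_left_comm _ ((-1 : ℝ) ^ (m + 1)), intervalIntegral.integral_const_mul]
  rw [← hsplit, hleft, hright, integral_greenLeft_add_integral_greenRight h ht, ← mul_assoc,
    ← mul_pow, neg_one_mul, neg_neg, one_pow, one_mul]

end BoggioGreenFunction

section RisingFactorial

lemma ascPochhammer_eval_add {S : Type*} [CommSemiring S] (x : S) (k l : ℕ) :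
    (ascPochhammer S (k + l)).eval x =
      (ascPochhammer S k).eval x * (ascPochhammer S l).eval (x + k) := by
  rw [← ascPochhammer_mul, eval_mul, eval_comp, eval_add, eval_X, eval_natCast]

lemma ascPochhammer_eval_neg_natCast {R : Type*} [CommRing R] (n k : ℕ) :
    (ascPochhammer R k).eval (-(n : R)) = (-1) ^ k * n.descFactorial k := by
  rw [ascPochhammer_eval_neg_eq_descPochhammer, descPochhammer_eval_eq_descFactorial]

lemma Gamma_add_natCast {x : ℝ} (hx : 0 < x) (k : ℕ) :
    Real.Gamma (x + k) = (ascPochhammer ℝ k).eval x * Real.Gamma x := by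
  induction k with
  | zero => simp
  | succ k ih =>
    rw [ascPochhammer_succ_eval, Nat.cast_succ, ← add_assoc, Real.Gamma_add_one (by positivity), ih]
    ring

lemma ascPochhammer_eval_div_factorial {K : Type*} [Field K] [CharZero K] [BinomialRing K] (x : K)
    (k : ℕ) : (ascPochhammer K k).eval x / k.factorial = Ring.multichoose x k := by
  rw [div_eq_iff (Nat.cast_ne_zero.2 k.factorial_ne_zero), mul_comm, ← nsmul_eq_mul,
    Ring.factorial_nsmul_multichoose_eq_ascPochhammer, ascPochhammer_smeval_eq_eval]

variable {R : Type*} [CommRing R] [BinomialRing R]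

lemma multichoose_eq_neg_one_pow_mul_choose_neg (x : R) (k : ℕ) :
    Ring.multichoose x k = (-1) ^ k * Ring.choose (-x) k := by
  rw [Ring.choose_neg']
  rcases k.even_or_odd with hk | hk
  · simp [hk.neg_one_pow, Int.negOnePow_even _ ((Int.even_coe_nat k).2 hk)]
  · simp [hk.neg_one_pow, Int.negOnePow_odd _ ((Int.odd_coe_nat k).2 hk)]

theorem multichoose_add (x y : R) (n : ℕ) : Ring.multichoose (x + y) n =
    ∑ ij ∈ Finset.HasAntidiagonal.antidiagonal n,
      Ring.multichoose x ij.1 * Ring.multichoose y ij.2 := by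
  simp only [multichoose_eq_neg_one_pow_mul_choose_neg]
  rw [neg_add, Ring.add_choose_eq n (Commute.all _ _), Finset.mul_sum]
  refine Finset.sum_congr rfl fun ij hij => ?_
  rw [← Finset.HasAntidiagonal.mem_antidiagonal.1 hij, pow_add]
  ring

end RisingFactorial

section HalfPochhammer

/-- The rising factorial `(1/2)_k`. -/
def halfPochhammer (k : ℕ) : ℝ := (ascPochhammer ℝ k).eval (1 / 2)

lemma halfPochhammer_zero : halfPochhammer 0 = 1 := by simp [halfPochhammer]

lemma halfPochhammer_succ (k : ℕ) : halfPochhammer (k + 1) = halfPochhammer k * (k + 1 / 2) := by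
  rw [halfPochhammer, ascPochhammer_succ_eval, halfPochhammer, add_comm (1 / 2 : ℝ)]

lemma halfPochhammer_pos (k : ℕ) : 0 < halfPochhammer k := ascPochhammer_pos k _ (by norm_num)

lemma halfPochhammer_add (k l : ℕ) :
    halfPochhammer (k + l) = halfPochhammer k * (ascPochhammer ℝ l).eval (k + 1 / 2 : ℝ) := by
  rw [halfPochhammer, ascPochhammer_eval_add, halfPochhammer, add_comm (1 / 2 : ℝ)]

lemma factorial_two_mul_eq (k : ℕ) :
    ((2 * k).factorial : ℝ) = 4 ^ k * k.factorial * halfPochhammer k := by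
  induction k with
  | zero => simp [halfPochhammer_zero]
  | succ k ih =>
    rw [mul_add_one, Nat.factorial_succ, Nat.factorial_succ, Nat.factorial_succ,
      halfPochhammer_succ]
    push_cast
    rw [ih]
    ring

lemma integral_one_sub_sq_pow_eq_halfPochhammer (k : ℕ) : ∫ x in (-1 : ℝ)..1, (1 - x ^ 2) ^ k =
    2 * k.factorial / ((2 * k + 1) * halfPochhammer k) := by
  rw [integral_one_sub_sq_pow, Nat.factorial_succ, Nat.cast_mul, factorial_two_mul_eq]
  have := (halfPochhammer_pos k).ne'
  have hpow : (2 : ℝ) ^ (2 * k + 1) = 2 * 4 ^ k := by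
    rw [pow_succ', pow_mul]
    norm_num
  push_cast
  rw [hpow]
  field_simp

lemma wallis_eq_halfPochhammer (n : ℕ) :
    Real.Wallis.W n = (n.factorial / halfPochhammer n) ^ 2 / (2 * n + 1) := by
  have := (halfPochhammer_pos n).ne'
  have hpow : (2 : ℝ) ^ (4 * n) = (4 ^ n) ^ 2 := by
    rw [← pow_mul, mul_comm n, pow_mul, pow_mul]
    norm_num
  rw [Real.Wallis.W_eq_factorial_ratio, factorial_two_mul_eq, hpow]
  field_simp

lemma eigenUpperBound_eq (n : ℕ) :
    eigenUpperBound n = 2 * n.factorial * halfPochhammer (2 * n) / halfPochhammer n := by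
  have hGamma (k : ℕ) : Real.Gamma (k + 1 / 2) = halfPochhammer k * Real.Gamma (1 / 2) := by
    rw [add_comm, Gamma_add_natCast (by norm_num), halfPochhammer]
  have hGamma_two_mul := hGamma (2 * n)
  have hGamma_half : Real.Gamma (1 / 2) ≠ 0 := (Real.Gamma_pos_of_pos (by norm_num)).ne'
  have := (halfPochhammer_pos n).ne'
  push_cast at hGamma_two_mul
  rw [eigenUpperBound, Real.Gamma_nat_eq_factorial, hGamma_two_mul, hGamma]
  field_simp

lemma eigenUpperBound_pos (n : ℕ) : 0 < eigenUpperBound n := by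
  have := halfPochhammer_pos
  rw [eigenUpperBound_eq]
  positivity [this n, this (2 * n)]

lemma eigenLowerBound_eq (n : ℕ) : eigenLowerBound n = eigenUpperBound n / ratioR n := by
  rw [eigenLowerBound, eigenUpperBound, div_div]

end HalfPochhammer

section RatioCoefficients

/-- The `k`-th term of the terminating series `R_n`, with the common sign `(-1) ^ k` of `(-n)_k` and
`(1 - 2n)_k` cancelled and both written as falling factorials. -/
def ratioCoeff (n k : ℕ) : ℝ :=
  halfPochhammer k * n.descFactorial k / ((2 * n - 1).descFactorial k * (n + 1).ascFactorial k)

lemma ratioCoeff_nonneg (n k : ℕ) : 0 ≤ ratioCoeff n k := by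
  have := halfPochhammer_pos k
  unfold ratioCoeff
  positivity

lemma ratioCoeff_zero (n : ℕ) : ratioCoeff n 0 = 1 := by simp [ratioCoeff, halfPochhammer_zero]

lemma ratioCoeff_eq_zero {n k : ℕ} (h : n < k) : ratioCoeff n k = 0 := by
  simp [ratioCoeff, Nat.descFactorial_of_lt h]

lemma ratioCoeff_one_pos {n : ℕ} (hn : 1 ≤ n) : 0 < ratioCoeff n 1 := by
  have := halfPochhammer_pos 1
  have : 0 < 2 * n - 1 := by omega
  simp only [ratioCoeff, Nat.descFactorial_one, Nat.ascFactorial_succ, Nat.ascFactorial_zero]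
  positivity

lemma ratioR_eq_sum {n : ℕ} (hn : 1 ≤ n) :
    ratioR n = ∑ k ∈ Finset.range (n + 1), ratioCoeff n k := by
  have hterm (k : ℕ) : (ascPochhammer ℝ k).eval (1 / 2) * (ascPochhammer ℝ k).eval 1 *
      (ascPochhammer ℝ k).eval (-(n : ℝ)) / ((ascPochhammer ℝ k).eval (1 - 2 * (n : ℝ)) *
        (ascPochhammer ℝ k).eval ((n : ℝ) + 1)) * (1 ^ k / k.factorial) = ratioCoeff n k := by
    have hlower : (1 : ℝ) - 2 * n = -((2 * n - 1 : ℕ) : ℝ) := by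
      push_cast [Nat.cast_sub (show 1 ≤ 2 * n by omega)]
      ring
    rw [hlower, ascPochhammer_eval_neg_natCast, ascPochhammer_eval_neg_natCast,
      ← Nat.cast_add_one n, ← Nat.cast_ascFactorial, ← Nat.cast_factorial, one_pow, ratioCoeff,
      halfPochhammer]
    have hfactorial : (k.factorial : ℝ) ≠ 0 := by positivity
    have hsign : (-1 : ℝ) ^ k ≠ 0 := by simp
    field_simp
  rw [ratioR, hypergeometric3F2, tsum_congr hterm]
  exact tsum_eq_sum fun k hk => ratioCoeff_eq_zero (by simpa [Nat.lt_succ_iff] using hk)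

lemma ratioCoeff_succ_le (n k : ℕ) :
    ratioCoeff n (k + 1) ≤ ratioCoeff n k * ((k + 1 / 2) / (n + 1 + k)) := by
  have hsucc : ratioCoeff n (k + 1) = ratioCoeff n k * ((k + 1 / 2) / (n + 1 + k)) *
      ((n - k : ℕ) / (2 * n - 1 - k : ℕ)) := by
    simp only [ratioCoeff, halfPochhammer_succ, Nat.descFactorial_succ, Nat.ascFactorial_succ]
    push_cast
    field_simp
  rw [hsucc]
  refine mul_le_of_le_one_right (mul_nonneg (ratioCoeff_nonneg n k) (by positivity)) ?_
  exact div_le_one_of_le₀ (by gcongr; omega) (by positivity)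

lemma ratioCoeff_succ_le_geometric (n k : ℕ) :
    ratioCoeff n (k + 1) ≤ (1 / 2) ^ (k + 1) * (1 / (n + 1)) := by
  induction k with
  | zero => simpa [ratioCoeff_zero, div_eq_mul_inv] using ratioCoeff_succ_le n 0
  | succ k ih =>
    rcases lt_or_ge n (k + 1) with hk | hk
    · rw [ratioCoeff_eq_zero (by omega)]
      positivity
    have hk' : (k + 1 : ℝ) ≤ n := by exact_mod_cast hk
    calc ratioCoeff n (k + 1 + 1)
      _ ≤ ratioCoeff n (k + 1) * (((k + 1 : ℕ) + 1 / 2) / (n + 1 + (k + 1 : ℕ))) :=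
        ratioCoeff_succ_le n (k + 1)
      _ ≤ ratioCoeff n (k + 1) * (1 / 2) := by
        refine mul_le_mul_of_nonneg_left ?_ (ratioCoeff_nonneg _ _)
        rw [div_le_div_iff₀ (by positivity) two_pos]
        push_cast
        linarith
      _ ≤ (1 / 2) ^ (k + 1 + 1) * (1 / (n + 1)) := by
        rw [pow_succ _ (k + 1)]
        linarith

lemma one_le_ratioR {n : ℕ} (hn : 1 ≤ n) : 1 ≤ ratioR n := by
  rw [ratioR_eq_sum hn, ← ratioCoeff_zero n]
  exact Finset.single_le_sum (fun k _ => ratioCoeff_nonneg n k) (by simp)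

lemma ratioR_le {n : ℕ} (hn : 1 ≤ n) : ratioR n ≤ 1 + 1 / (n + 1) := by
  rw [ratioR_eq_sum hn, Finset.sum_range_succ', ratioCoeff_zero, add_comm]
  gcongr
  have hgeometric : ∑ k ∈ Finset.range n, (1 / 2 : ℝ) ^ (k + 1) ≤ 1 := by
    simp only [pow_succ, ← Finset.sum_mul]
    have := summable_geometric_two.sum_le_tsum (Finset.range n) fun k _ => by positivity
    rw [tsum_geometric_two] at this
    linarith
  calc ∑ k ∈ Finset.range n, ratioCoeff n (k + 1)
    _ ≤ ∑ k ∈ Finset.range n, (1 / 2) ^ (k + 1) * (1 / (n + 1) : ℝ) :=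
      Finset.sum_le_sum fun k _ => ratioCoeff_succ_le_geometric n k
    _ ≤ 1 / (n + 1) := by
      rw [← Finset.sum_mul]
      exact mul_le_of_le_one_left (by positivity) hgeometric

theorem tendsto_ratioR : Tendsto ratioR atTop (𝓝 1) := by
  have hupper : Tendsto (fun n : ℕ => (1 : ℝ) + 1 / ((n : ℝ) + 1)) atTop (𝓝 1) := by
    simpa using (tendsto_one_div_add_atTop_nhds_zero_nat (𝕜 := ℝ)).const_add 1
  refine tendsto_of_tendsto_of_tendsto_of_le_of_le' tendsto_const_nhds hupper ?_ ?_ <;>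
    filter_upwards [eventually_ge_atTop 1] with n hn
  exacts [one_le_ratioR hn, ratioR_le hn]

end RatioCoefficients

section ComparisonPolynomial

lemma factorial_div_factorial_two_mul_add_one (m : ℕ) :
    (m.factorial : ℝ) / (2 * m + 1).factorial = 2 / (4 ^ (m + 1) * halfPochhammer (m + 1)) := by
  have hdouble := factorial_two_mul_eq (m + 1)
  have := halfPochhammer_pos (m + 1)
  rw [mul_add_one, Nat.factorial_succ, Nat.factorial_succ m] at hdouble
  push_cast at hdouble
  rw [div_eq_div_iff (by positivity) (by positivity)]
  refine mul_left_cancel₀ (show (m + 1 : ℝ) ≠ 0 by positivity) ?_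
  linarith

lemma cast_descFactorial_eq_div {n k l : ℕ} (h : k + l = n) :
    (n.descFactorial k : ℝ) = n.factorial / l.factorial := by
  rw [eq_div_iff (by positivity), mul_comm, ← Nat.cast_mul, ← show n - k = l by omega,
    Nat.factorial_mul_descFactorial (by omega)]

lemma ratioCoeff_eq_factorial {m k j : ℕ} (hkj : k + j = m + 1) :
    ratioCoeff (m + 1) k = halfPochhammer k * ((m + 1).factorial : ℝ) ^ 2 * (m + j).factorial /
      (j.factorial * (2 * m + 1).factorial * (m + 1 + k).factorial) := by
  have hasc : ((m + 1 + 1).ascFactorial k : ℝ) = (m + 1 + k).factorial / (m + 1).factorial := by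
    rw [eq_div_iff (by positivity), mul_comm, ← Nat.cast_mul, Nat.factorial_mul_ascFactorial]
  rw [ratioCoeff, cast_descFactorial_eq_div hkj, show 2 * (m + 1) - 1 = 2 * m + 1 by omega,
    cast_descFactorial_eq_div (show k + (m + j) = 2 * m + 1 by omega), hasc]
  field_simp

lemma ratioCoeff_mul_choose_eq {m r i j : ℕ} (hrij : r + i + j = m + 1) :
    ratioCoeff (m + 1) (r + i) * (m + 1 + (r + i)).choose (m + 1 + r) =
      halfPochhammer r * ((m + 1).factorial : ℝ) ^ 2 / (m + 1 + r).factorial *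
        (m.factorial / (2 * m + 1).factorial) *
          (Ring.multichoose (r + 1 / 2 : ℝ) i * Ring.multichoose (m + 1 : ℝ) j) := by
  have hasc : ((m + j).factorial : ℝ) = m.factorial * (ascPochhammer ℝ j).eval (m + 1 : ℝ) := by
    rw [← Nat.cast_add_one, ← Nat.cast_ascFactorial, ← Nat.cast_mul,
      Nat.factorial_mul_ascFactorial]
  rw [ratioCoeff_eq_factorial hrij, hasc, halfPochhammer_add, ← ascPochhammer_eval_div_factorial,
    ← ascPochhammer_eval_div_factorial, ← add_assoc, Nat.cast_add_choose]
  field_simp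

/-- The terms of `R_n` solve the triangular linear system which makes the operator
`(-1) ^ n D ^ (2n)` map `comparisonPoly n` to a multiple of `(1 - X ^ 2) ^ n`. -/
theorem sum_ratioCoeff_mul_choose {n r : ℕ} (hn : 1 ≤ n) (hr : r ≤ n) :
    ∑ k ∈ Finset.range (n + 1), ratioCoeff n k * (n + k).choose (n + r) =
      eigenUpperBound n * n.choose r * (2 * r).factorial / (2 * (n + r)).factorial := by
  obtain ⟨m, rfl⟩ := Nat.exists_eq_add_of_le' hn
  obtain ⟨N, hN⟩ := Nat.exists_eq_add_of_le hr
  have hvanish : ∑ k ∈ Finset.range r,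
      ratioCoeff (m + 1) k * (m + 1 + k).choose (m + 1 + r) = 0 :=
    Finset.sum_eq_zero fun k hk => by
      rw [Nat.choose_eq_zero_of_lt (by have := Finset.mem_range.1 hk; omega), Nat.cast_zero,
        mul_zero]
  have hsplit : halfPochhammer (2 * (m + 1)) = halfPochhammer (m + 1 + r) *
      (ascPochhammer ℝ N).eval (r + 1 / 2 + (m + 1) : ℝ) := by
    rw [show 2 * (m + 1) = (m + 1 + r) + N by omega, halfPochhammer_add]
    push_cast
    ring_nf
  have := halfPochhammer_pos (m + 1)
  have := halfPochhammer_pos (m + 1 + r)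
  have := halfPochhammer_pos r
  calc ∑ k ∈ Finset.range (m + 1 + 1), ratioCoeff (m + 1) k * (m + 1 + k).choose (m + 1 + r)
    _ = ∑ ij ∈ Finset.HasAntidiagonal.antidiagonal N,
        ratioCoeff (m + 1) (r + ij.1) * (m + 1 + (r + ij.1)).choose (m + 1 + r) := by
      rw [show m + 1 + 1 = r + (N + 1) by omega, Finset.sum_range_add, hvanish, zero_add,
        Finset.Nat.sum_antidiagonal_eq_sum_range_succ_mk]
    _ = halfPochhammer r * ((m + 1).factorial : ℝ) ^ 2 / (m + 1 + r).factorial *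
        (m.factorial / (2 * m + 1).factorial) *
          Ring.multichoose (r + 1 / 2 + (m + 1) : ℝ) N := by
      rw [multichoose_add, Finset.mul_sum]
      refine Finset.sum_congr rfl fun ij hij => ratioCoeff_mul_choose_eq ?_
      rw [add_assoc, Finset.HasAntidiagonal.mem_antidiagonal.1 hij, hN]
    _ = _ := by
      rw [factorial_div_factorial_two_mul_add_one, ← ascPochhammer_eval_div_factorial,
        eigenUpperBound_eq, hsplit, factorial_two_mul_eq r, factorial_two_mul_eq (m + 1 + r),
        Nat.cast_choose ℝ hr, show m + 1 - r = N by omega]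
      field_simp
      ring

lemma coeff_one_sub_X_pow {R : Type*} [CommRing R] (N i : ℕ) :
    ((1 - X : R[X]) ^ N).coeff i = (-1) ^ i * N.choose i := by
  have hcomp : (1 - X : R[X]) ^ N = ((1 + X) ^ N).comp (C (-1) * X) := by
    simp [sub_eq_add_neg]
  rw [hcomp, comp_C_mul_X_coeff, coeff_one_add_X_pow, mul_comm]

lemma coeff_one_sub_X_sq_pow {R : Type*} [CommRing R] (N j : ℕ) :
    ((1 - X ^ 2 : R[X]) ^ N).coeff j =
      if 2 ∣ j then (-1) ^ (j / 2) * (N.choose (j / 2) : R) else 0 := by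
  have hexpand : (1 - X ^ 2 : R[X]) ^ N = expand R 2 ((1 - X) ^ N) := by simp
  rw [hexpand, coeff_expand two_pos, coeff_one_sub_X_pow]

/-- The polynomial `∑ₖ cₖ (1 - X²) ^ (n + k)`, with `cₖ` the terms of `R_n`. It satisfies the
Dirichlet conditions of order `n` at `±1`, lies between `(1 - t²) ^ n` and `R_n (1 - t²) ^ n`, and
`(-1) ^ n D ^ (2n)` maps it to a multiple of `(1 - X²) ^ n`. -/
def comparisonPoly (n : ℕ) : ℝ[X] :=
  ∑ k ∈ Finset.range (n + 1), C (ratioCoeff n k) * (1 - X ^ 2) ^ (n + k)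

lemma pow_dvd_comparisonPoly (n : ℕ) : (1 - X ^ 2 : ℝ[X]) ^ n ∣ comparisonPoly n :=
  Finset.dvd_sum fun _ _ => Dvd.dvd.mul_left (pow_dvd_pow _ (by omega)) _

lemma coeff_comparisonPoly (n i : ℕ) : (comparisonPoly n).coeff (2 * i) =
    (-1) ^ i * ∑ k ∈ Finset.range (n + 1), ratioCoeff n k * (n + k).choose i := by
  simp only [comparisonPoly, finsetSum_coeff, coeff_C_mul, coeff_one_sub_X_sq_pow, dvd_mul_right,
    if_true, Nat.mul_div_cancel_left i two_pos, Finset.mul_sum, mul_left_comm]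

theorem iterate_derivative_comparisonPoly {n : ℕ} (hn : 1 ≤ n) :
    derivative^[2 * n] (comparisonPoly n) =
      C ((-1) ^ n * eigenUpperBound n) * (1 - X ^ 2) ^ n := by
  ext j
  rw [coeff_iterate_derivative, coeff_C_mul, nsmul_eq_mul, coeff_one_sub_X_sq_pow]
  split_ifs with hj
  · obtain ⟨r, rfl⟩ := hj
    rw [Nat.mul_div_cancel_left r two_pos, show 2 * r + 2 * n = 2 * (n + r) by ring,
      coeff_comparisonPoly]
    rcases le_or_gt r n with hr | hr
    · rw [sum_ratioCoeff_mul_choose hn hr,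
        cast_descFactorial_eq_div (mul_add 2 n r).symm, pow_add]
      field_simp
    · rw [Nat.choose_eq_zero_of_lt hr, Finset.sum_eq_zero fun k hk => ?_]
      · simp
      · rw [Nat.choose_eq_zero_of_lt (by have := Finset.mem_range.1 hk; omega), Nat.cast_zero,
          mul_zero]
  · have hodd : ¬ 2 ∣ j + 2 * n := by omega
    simp [comparisonPoly, finsetSum_coeff, coeff_one_sub_X_sq_pow, hodd]

lemma iterate_derivative_one_sub_X_sq_pow {R : Type*} [CommRing R] (n : ℕ) :
    derivative^[2 * n] ((1 - X ^ 2 : R[X]) ^ n) = C ((-1) ^ n * ((2 * n).factorial : R)) := by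
  ext j
  rw [coeff_iterate_derivative, coeff_C, nsmul_eq_mul]
  split_ifs with hj
  · simp [hj, coeff_one_sub_X_sq_pow, Nat.descFactorial_self, mul_comm]
  · have hdegree : ((1 - X ^ 2 : R[X]) ^ n).natDegree ≤ n * 2 :=
      natDegree_pow_le_of_le n (by compute_degree)
    rw [coeff_eq_zero_of_natDegree_lt (by omega), mul_zero]

variable {n : ℕ} {t : ℝ}

lemma eval_comparisonPoly (n : ℕ) (t : ℝ) : (comparisonPoly n).eval t =
    (1 - t ^ 2) ^ n * ∑ k ∈ Finset.range (n + 1), ratioCoeff n k * (1 - t ^ 2) ^ k := by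
  simp only [comparisonPoly, eval_finsetSum, eval_mul, eval_C, eval_pow, eval_sub, eval_one, eval_X,
    Finset.mul_sum, pow_add, mul_left_comm]

lemma eval_comparisonPoly_le (hn : 1 ≤ n) (ht : t ∈ Icc (-1 : ℝ) 1) :
    (comparisonPoly n).eval t ≤ ratioR n * (1 - t ^ 2) ^ n := by
  have hnonneg : 0 ≤ 1 - t ^ 2 := by nlinarith [ht.1, ht.2]
  rw [eval_comparisonPoly, ratioR_eq_sum hn, mul_comm]
  gcongr with k
  exact mul_le_of_le_one_right (ratioCoeff_nonneg n k)
    (pow_le_one₀ hnonneg (sub_le_self 1 (sq_nonneg t)))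

lemma eval_comparisonPoly_lt (hn : 1 ≤ n) (ht : t ∈ Ioo (-1 : ℝ) 1) (ht0 : t ≠ 0) :
    (comparisonPoly n).eval t < ratioR n * (1 - t ^ 2) ^ n := by
  have hpos : 0 < 1 - t ^ 2 := by nlinarith [ht.1, ht.2]
  have hlt : 1 - t ^ 2 < 1 := sub_lt_self 1 (by positivity)
  rw [eval_comparisonPoly, ratioR_eq_sum hn, mul_comm]
  refine mul_lt_mul_of_pos_right (Finset.sum_lt_sum (fun k _ => ?_) ⟨1, ?_, ?_⟩) (by positivity)
  · exact mul_le_of_le_one_right (ratioCoeff_nonneg n k) (pow_le_one₀ hpos.le hlt.le)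
  · exact Finset.mem_range.2 (by omega)
  · rw [pow_one]
    exact mul_lt_of_lt_one_right (ratioCoeff_one_pos hn) hlt

end ComparisonPolynomial

section IntervalMeasure

attribute [local instance] Measure.Subtype.measureSpace

variable {a b : ℝ}

instance isFiniteMeasure_volume_Icc : IsFiniteMeasure (volume : Measure (Icc a b)) :=
  ⟨by simp [Measure.Subtype.volume_univ nullMeasurableSet_Icc]⟩

lemma isOpenPosMeasure_volume_Icc (hab : a < b) :
    (volume : Measure (Icc a b)).IsOpenPosMeasure := by
  refine ⟨fun U hU ⟨x, hx⟩ => ?_⟩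
  obtain ⟨V, hV, rfl⟩ := isOpen_induced_iff.1 hU
  have hne : (V ∩ Ioo a b).Nonempty := by
    have hcl : (x : ℝ) ∈ closure (Ioo a b) := by
      rw [closure_Ioo hab.ne]
      exact x.2
    exact mem_closure_iff.1 hcl V hV hx
  rw [volume_preimage_coe nullMeasurableSet_Icc hV.measurableSet]
  exact (((hV.inter isOpen_Ioo).measure_pos volume hne).trans_le
    (measure_mono (inter_subset_inter_right V Ioo_subset_Icc_self))).ne'

lemma integral_subtype_Icc {E : Type*} [NormedAddCommGroup E] [NormedSpace ℝ E] (hab : a ≤ b)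
    (F : ℝ → E) : ∫ s : Icc a b, F s = ∫ s in a..b, F s := by
  rw [integral_subtype measurableSet_Icc, integral_Icc_eq_integral_Ioc,
    intervalIntegral.integral_of_le hab]

lemma dense_preimage_compl_of_finite (hab : a < b) {s : Set ℝ} (hs : s.Finite) :
    Dense {t : Icc a b | (t : ℝ) ∉ s} := by
  have : Nontrivial (Icc a b) :=
    ⟨⟨a, left_mem_Icc.2 hab.le⟩, ⟨b, right_mem_Icc.2 hab.le⟩,
      fun h => hab.ne (congrArg Subtype.val h)⟩
  have hfinite : {t : Icc a b | (t : ℝ) ∈ s}.Finite := hs.preimage Subtype.val_injective.injOn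
  simpa only [← compl_eq_univ_sdiff] using! dense_univ.sdiff_finite hfinite

end IntervalMeasure

section DirichletInverse

attribute [local instance] Measure.Subtype.measureSpace

local notation "𝕀" => Icc (-1 : ℝ) 1

instance isOpenPosMeasure_volume_Icc_neg_one_one : (volume : Measure 𝕀).IsOpenPosMeasure :=
  isOpenPosMeasure_volume_Icc (by norm_num)

/-- Boggio's Green function as a continuous integral kernel. -/
def greenKernel (m : ℕ) : C(𝕀 × 𝕀, ℝ) :=
  ⟨fun x => green m x.1 x.2, (continuous_green m).comp
    (continuous_subtype_val.prodMap continuous_subtype_val)⟩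

lemma greenKernel_nonneg (m : ℕ) : 0 ≤ greenKernel m := fun x => green_nonneg m x.1.2 x.2.2

/-- The operator solving `(-1) ^ (m+1) u⁽²ᵐ⁺²⁾ = f` with Dirichlet boundary conditions, on square
integrable `f` and with continuous values. -/
def dirichletSolution (m : ℕ) : Lp ℝ 2 (volume : Measure 𝕀) →L[ℝ] C(𝕀, ℝ) :=
  kernelSmoothing volume (greenKernel m)

/-- The inverse of `(-1) ^ (m+1) D ^ (2m+2)` with Dirichlet boundary conditions. -/
def dirichletInverse (m : ℕ) : Lp ℝ 2 (volume : Measure 𝕀) →L[ℝ] Lp ℝ 2 (volume : Measure 𝕀) :=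
  kernelOperator volume (greenKernel m)

variable {m : ℕ}

lemma dirichletInverse_toLp (f : C(𝕀, ℝ)) :
    dirichletInverse m (f.toLp 2 volume ℝ) =
      (dirichletSolution m (f.toLp 2 volume ℝ)).toLp 2 volume ℝ := rfl

lemma dirichletSolution_toLp_apply {φ : ℕ → ℝ → ℝ} (h : IsDirichletChain (-1) 1 (m + 1) φ)
    {f : C(𝕀, ℝ)} (hf : ∀ s : 𝕀, f s = (-1) ^ (m + 1) * φ (2 * (m + 1)) s) (t : 𝕀) :
    dirichletSolution m (f.toLp 2 volume ℝ) t = φ 0 t := by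
  rw [← integral_green_mul h t.2, ← integral_subtype_Icc (by norm_num)]
  simp only [dirichletSolution, kernelSmoothing_toLp, hf]
  rfl

lemma exists_isDirichletChain_of_continuousMap (m : ℕ) (f : C(𝕀, ℝ)) :
    ∃ φ, IsDirichletChain (-1) 1 (m + 1) φ ∧
      ∀ s : 𝕀, f s = (-1) ^ (m + 1) * φ (2 * (m + 1)) s := by
  have hF : Continuous fun s => (-1) ^ (m + 1) * f (projIcc (-1 : ℝ) 1 (by norm_num) s) :=
    continuous_const.mul (f.continuous.comp continuous_projIcc)
  obtain ⟨φ, hφ, hφF⟩ := exists_isDirichletChain (a := -1) (b := 1) (by norm_num) (m + 1) hF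
  refine ⟨φ, hφ, fun s => ?_⟩
  simp [hφF, ← mul_assoc, ← mul_pow]

lemma inner_dirichletInverse {φ χ : ℕ → ℝ → ℝ} (hφ : IsDirichletChain (-1) 1 (m + 1) φ)
    (hχ : IsDirichletChain (-1) 1 (m + 1) χ) {f g : C(𝕀, ℝ)}
    (hf : ∀ s : 𝕀, f s = (-1) ^ (m + 1) * φ (2 * (m + 1)) s)
    (hg : ∀ s : 𝕀, g s = (-1) ^ (m + 1) * χ (2 * (m + 1)) s) :
    ⟪dirichletInverse m (f.toLp 2 volume ℝ), g.toLp 2 volume ℝ⟫_ℝ =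
      ∫ t in (-1)..1, φ (m + 1) t * χ (m + 1) t := by
  have hpairing : ⟪dirichletInverse m (f.toLp 2 volume ℝ), g.toLp 2 volume ℝ⟫_ℝ =
      ∫ s : 𝕀, φ 0 s * ((-1) ^ (m + 1) * χ (2 * (m + 1)) s) := by
    rw [dirichletInverse_toLp, inner_toLp_eq_integral]
    simp only [dirichletSolution_toLp_apply hφ hf, hg]
  rw [hpairing, integral_subtype_Icc (by norm_num)
    fun s => φ 0 s * ((-1) ^ (m + 1) * χ (2 * (m + 1)) s), hφ.integral_mul_last (by norm_num) hχ]

theorem isPositive_dirichletInverse (m : ℕ) : (dirichletInverse m).IsPositive := by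
  refine isPositive_of_forall_toLp (fun f g => ?_) fun f => ?_
  · obtain ⟨φ, hφ, hf⟩ := exists_isDirichletChain_of_continuousMap m f
    obtain ⟨χ, hχ, hg⟩ := exists_isDirichletChain_of_continuousMap m g
    rw [real_inner_comm _ (f.toLp 2 volume ℝ), inner_dirichletInverse hφ hχ hf hg,
      inner_dirichletInverse hχ hφ hg hf]
    simp only [mul_comm]
  · obtain ⟨φ, hφ, hf⟩ := exists_isDirichletChain_of_continuousMap m f
    rw [inner_dirichletInverse hφ hφ hf hf]
    exact intervalIntegral.integral_nonneg (by norm_num) fun t _ => mul_self_nonneg _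

lemma exists_eq_smul_dirichletSolution_of_mem {μ : ℝ} (hμ : μ ∈ polyharmonicEigenvalues (m + 1)) :
    ∃ f : C(𝕀, ℝ), f ≠ 0 ∧ f = μ • dirichletSolution m (f.toLp 2 volume ℝ) := by
  obtain ⟨ψ, hψ⟩ := hμ
  have hchain := IsDerivChain.of_contDiffOn (uniqueDiffOn_Icc (by norm_num)) hψ.contDiffOn
  have hdirichlet : IsDirichletChain (-1) 1 (m + 1) fun j => iteratedDerivWithin j ψ 𝕀 :=
    ⟨hchain, hψ.left_boundary, hψ.right_boundary⟩
  have hequation : EqOn (fun t => (-1) ^ (m + 1) * iteratedDerivWithin (2 * (m + 1)) ψ 𝕀 t)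
      (fun t => μ * ψ t) 𝕀 := by
    refine EqOn.of_subset_closure (s := Ioo (-1) 1) hψ.equation
      (continuousOn_const.mul hchain.continuousOn_last)
      (continuousOn_const.mul hψ.contDiffOn.continuousOn) Ioo_subset_Icc_self ?_
    rw [closure_Ioo (by norm_num)]
  set f : C(𝕀, ℝ) := ⟨Set.domRestrict (Icc (-1) 1) ψ, hψ.contDiffOn.continuousOn.domRestrict⟩
  refine ⟨f, fun hzero => ?_, ?_⟩
  · obtain ⟨t, ht, hne⟩ := hψ.ne_zero
    exact hne (DFunLike.congr_fun hzero (⟨t, ht⟩ : 𝕀))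
  · ext t
    rw [← map_smul, ← map_smul, dirichletSolution_toLp_apply hdirichlet
      (fun s => (hequation s.2).symm) t, iteratedDerivWithin_zero]
    rfl

lemma mem_polyharmonicEigenvalues_of_eq_smul {μ : ℝ} {f : C(𝕀, ℝ)} (hf0 : f ≠ 0)
    (hf : f = μ • dirichletSolution m (f.toLp 2 volume ℝ)) :
    μ ∈ polyharmonicEigenvalues (m + 1) := by
  obtain ⟨φ, hφ, hfφ⟩ := exists_isDirichletChain_of_continuousMap m f
  have hfφ0 (t : 𝕀) : f t = μ * φ 0 t := by
    rw [← dirichletSolution_toLp_apply hφ hfφ]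
    exact DFunLike.congr_fun hf t
  have hderiv {j : ℕ} (hj : j ≤ 2 * (m + 1)) : EqOn (iteratedDerivWithin j (φ 0) 𝕀) (φ j) 𝕀 :=
    hφ.iteratedDerivWithin_eq (uniqueDiffOn_Icc (by norm_num)) hj
  refine ⟨φ 0, hφ.contDiffOn (uniqueDiffOn_Icc (by norm_num)), ?_, fun t ht => ?_, fun j hj => ?_,
    fun j hj => ?_⟩
  · obtain ⟨t, ht⟩ := DFunLike.ne_iff.1 hf0
    exact ⟨t, t.2, fun hzero => ht (by rw [hfφ0, hzero, mul_zero]; rfl)⟩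
  · have ht' : t ∈ 𝕀 := Ioo_subset_Icc_self ht
    rw [hderiv le_rfl ht', ← hfφ ⟨t, ht'⟩, hfφ0]
  · rw [hderiv (by omega) (by norm_num), hφ.left j hj]
  · rw [hderiv (by omega) (by norm_num), hφ.right j hj]

theorem polyharmonicEigenvalues_succ_eq (m : ℕ) :
    polyharmonicEigenvalues (m + 1) = {μ : ℝ | ∃ u ≠ 0, u = μ • dirichletInverse m u} := by
  ext μ
  refine ⟨fun hμ => exists_eq_smul_kernelOperator_iff.2 <|
    exists_eq_smul_dirichletSolution_of_mem hμ, fun hμ => ?_⟩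
  obtain ⟨f, hf0, hf⟩ := exists_eq_smul_kernelOperator_iff.1 hμ
  exact mem_polyharmonicEigenvalues_of_eq_smul hf0 hf

lemma isDirichletChain_of_dvd {a b : ℝ} {n : ℕ} {P : ℝ[X]} (ha : (X - C a) ^ n ∣ P)
    (hb : (X - C b) ^ n ∣ P) : IsDirichletChain a b n fun j t => (derivative^[j] P).eval t :=
  ⟨.of_polynomial _ _ P, X_sub_C_pow_dvd_iff_forall_eval_iterate_derivative.1 ha,
    X_sub_C_pow_dvd_iff_forall_eval_iterate_derivative.1 hb⟩

lemma isDirichletChain_of_one_sub_X_sq_pow_dvd {n : ℕ} {P : ℝ[X]} (hP : (1 - X ^ 2) ^ n ∣ P) :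
    IsDirichletChain (-1) 1 n fun j t => (derivative^[j] P).eval t :=
  isDirichletChain_of_dvd
    ((pow_dvd_pow_of_dvd ⟨1 - X, by rw [C_neg, C_1]; ring⟩ n).trans hP)
    ((pow_dvd_pow_of_dvd ⟨-(1 + X), by rw [C_1]; ring⟩ n).trans hP)

lemma dirichletSolution_polynomial {P : ℝ[X]} (hP : (1 - X ^ 2) ^ (m + 1) ∣ P) :
    dirichletSolution m
        (((-1) ^ (m + 1) * derivative^[2 * (m + 1)] P).toContinuousMapOn 𝕀 |>.toLp 2 volume ℝ) =
      P.toContinuousMapOn 𝕀 := by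
  ext t
  exact dirichletSolution_toLp_apply (isDirichletChain_of_one_sub_X_sq_pow_dvd hP)
    (fun s => by simp) t

lemma dirichletInverse_ne_zero (m : ℕ) : dirichletInverse m ≠ 0 := fun hzero => by
  have hsol := dirichletSolution_polynomial (dvd_refl ((1 - X ^ 2 : ℝ[X]) ^ (m + 1)))
  have : ((1 - X ^ 2 : ℝ[X]) ^ (m + 1)).toContinuousMapOn 𝕀 = 0 := by
    refine ContinuousMap.toLp_injective (p := 2) (𝕜 := ℝ) volume ?_
    rw [← hsol, ← dirichletInverse_toLp, hzero, map_zero]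
    rfl
  simpa using DFunLike.congr_fun this (⟨0, by norm_num⟩ : 𝕀)

theorem isLeast_norm_dirichletInverse_inv (m : ℕ) :
    IsLeast (polyharmonicEigenvalues (m + 1)) ‖dirichletInverse m‖⁻¹ := by
  rw [polyharmonicEigenvalues_succ_eq]
  exact isLeast_inv_norm_of_isPositive (isPositive_dirichletInverse m)
    (isCompactOperator_kernelOperator volume (greenKernel m)) (dirichletInverse_ne_zero m)

theorem minEigenvalue_succ_eq (m : ℕ) : minEigenvalue (m + 1) = ‖dirichletInverse m‖⁻¹ :=
  (isLeast_norm_dirichletInverse_inv m).csInf_eq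

lemma minEigenvalue_succ_pos (m : ℕ) : 0 < minEigenvalue (m + 1) := by
  rw [minEigenvalue_succ_eq, inv_pos, norm_pos_iff]
  exact dirichletInverse_ne_zero m

lemma smul_dirichletSolution_one (m : ℕ) :
    ((2 * (m + 1)).factorial : ℝ) • dirichletSolution m ((1 : C(𝕀, ℝ)).toLp 2 volume ℝ) =
      ((1 - X ^ 2) ^ (m + 1) : ℝ[X]).toContinuousMapOn 𝕀 := by
  rw [← dirichletSolution_polynomial dvd_rfl, iterate_derivative_one_sub_X_sq_pow, ← map_smul,
    ← map_smul]
  congr 2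
  ext t
  simp [← mul_assoc, ← mul_pow]

lemma smul_dirichletSolution_one_sub_X_sq_pow (m : ℕ) :
    eigenUpperBound (m + 1) • dirichletSolution m
        (((1 - X ^ 2) ^ (m + 1) : ℝ[X]).toContinuousMapOn 𝕀 |>.toLp 2 volume ℝ) =
      (comparisonPoly (m + 1)).toContinuousMapOn 𝕀 := by
  rw [← dirichletSolution_polynomial (pow_dvd_comparisonPoly (m + 1)),
    iterate_derivative_comparisonPoly m.succ_pos, ← map_smul, ← map_smul]
  congr 2
  ext t
  simp [← mul_assoc, ← mul_pow]

lemma dirichletSolution_one_apply (m : ℕ) (t : 𝕀) :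
    dirichletSolution m ((1 : C(𝕀, ℝ)).toLp 2 volume ℝ) t =
      (1 - (t : ℝ) ^ 2) ^ (m + 1) / (2 * (m + 1)).factorial := by
  rw [eq_div_iff (by positivity), mul_comm]
  simpa using DFunLike.congr_fun (smul_dirichletSolution_one m) t

lemma dirichletSolution_one_sub_X_sq_pow_apply (m : ℕ) (t : 𝕀) :
    dirichletSolution m
        (((1 - X ^ 2) ^ (m + 1) : ℝ[X]).toContinuousMapOn 𝕀 |>.toLp 2 volume ℝ) t =
      (comparisonPoly (m + 1)).eval (t : ℝ) / eigenUpperBound (m + 1) := by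
  rw [eq_div_iff (eigenUpperBound_pos _).ne', mul_comm]
  exact DFunLike.congr_fun (smul_dirichletSolution_one_sub_X_sq_pow m) t

lemma inner_dirichletInverse_one (m : ℕ) :
    ⟪dirichletInverse m ((1 : C(𝕀, ℝ)).toLp 2 volume ℝ), (1 : C(𝕀, ℝ)).toLp 2 volume ℝ⟫_ℝ =
      (∫ t in (-1)..1, (1 - t ^ 2) ^ (m + 1)) / (2 * (m + 1)).factorial := by
  rw [dirichletInverse_toLp, inner_toLp_eq_integral, ← intervalIntegral.integral_div,
    ← integral_subtype_Icc (by norm_num)]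
  simp only [dirichletSolution_one_apply, ContinuousMap.one_apply, mul_one]

lemma norm_sq_dirichletInverse_one (m : ℕ) :
    ‖dirichletInverse m ((1 : C(𝕀, ℝ)).toLp 2 volume ℝ)‖ ^ 2 =
      (∫ t in (-1)..1, (1 - t ^ 2) ^ (2 * (m + 1))) / ((2 * (m + 1)).factorial : ℝ) ^ 2 := by
  rw [← real_inner_self_eq_norm_sq, dirichletInverse_toLp, inner_toLp_eq_integral,
    ← intervalIntegral.integral_div, ← integral_subtype_Icc (by norm_num)]
  simp only [dirichletSolution_one_apply, ← sq, div_pow, pow_mul']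

lemma minEigenvalue_mul_norm_sq_le (m : ℕ) (u : Lp ℝ 2 (volume : Measure 𝕀)) :
    minEigenvalue (m + 1) * ‖dirichletInverse m u‖ ^ 2 ≤ ⟪dirichletInverse m u, u⟫_ℝ := by
  rw [minEigenvalue_succ_eq, inv_mul_le_iff₀ (norm_pos_iff.2 (dirichletInverse_ne_zero m))]
  exact norm_apply_sq_le_of_isPositive (isPositive_dirichletInverse m) u

theorem isLeast_minEigenvalue {n : ℕ} (hn : 1 ≤ n) :
    IsLeast (polyharmonicEigenvalues n) (minEigenvalue n) := by
  obtain ⟨m, rfl⟩ := Nat.exists_eq_add_of_le' hn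
  rw [minEigenvalue_succ_eq]
  exact isLeast_norm_dirichletInverse_inv m

theorem minEigenvalue_lt_eigenUpperBound {n : ℕ} (hn : 1 ≤ n) :
    minEigenvalue n < eigenUpperBound n := by
  obtain ⟨m, rfl⟩ := Nat.exists_eq_add_of_le' hn
  have hquotient := minEigenvalue_mul_norm_sq_le m ((1 : C(𝕀, ℝ)).toLp 2 volume ℝ)
  rw [inner_dirichletInverse_one, norm_sq_dirichletInverse_one,
    integral_one_sub_sq_pow_eq_halfPochhammer,
    integral_one_sub_sq_pow_eq_halfPochhammer] at hquotient
  rw [eigenUpperBound_eq]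
  generalize m + 1 = n at *
  have := halfPochhammer_pos n
  have := halfPochhammer_pos (2 * n)
  rw [← le_div_iff₀ (by positivity)] at hquotient
  refine hquotient.trans_lt ?_
  push_cast
  field_simp
  linarith

theorem eigenLowerBound_lt_minEigenvalue {n : ℕ} (hn : 1 ≤ n) :
    eigenLowerBound n < minEigenvalue n := by
  obtain ⟨m, rfl⟩ := Nat.exists_eq_add_of_le' hn
  have hU := eigenUpperBound_pos (m + 1)
  have hR : 0 < ratioR (m + 1) := zero_lt_one.trans_le (one_le_ratioR hn)
  obtain ⟨f, hf0, hf⟩ := exists_eq_smul_dirichletSolution_of_mem (isLeast_minEigenvalue hn).1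
  have hdense : Dense {t : 𝕀 | (t : ℝ) ∉ ({-1, 0, 1} : Set ℝ)} :=
    dense_preimage_compl_of_finite (by norm_num) (by simp)
  have hone_lt : 1 < minEigenvalue (m + 1) * (ratioR (m + 1) / eigenUpperBound (m + 1)) := by
    refine one_lt_mul_of_eq_smul_kernelSmoothing (greenKernel_nonneg m)
      (isPositive_dirichletInverse m).isSymmetric hf0 (minEigenvalue_succ_pos m) hf
      (w := ((1 - X ^ 2) ^ (m + 1) : ℝ[X]).toContinuousMapOn 𝕀) (fun t => ?_) (fun t => ?_)
      (hdense.mono fun t ht => ?_)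
    · have : 0 ≤ 1 - (t : ℝ) ^ 2 := by nlinarith [t.2.1, t.2.2]
      simpa using pow_nonneg this _
    · refine (dirichletSolution_one_sub_X_sq_pow_apply m t).trans_le ?_
      simpa [div_mul_eq_mul_div] using
        div_le_div_of_nonneg_right (eval_comparisonPoly_le hn t.2) hU.le
    · simp only [mem_insert_iff, mem_singleton_iff, not_or] at ht
      refine (dirichletSolution_one_sub_X_sq_pow_apply m t).trans_lt ?_
      simpa [div_mul_eq_mul_div] using div_lt_div_of_pos_right (eval_comparisonPoly_lt hn
        ⟨t.2.1.lt_of_ne' ht.1, t.2.2.lt_of_ne ht.2.2⟩ ht.2.1) hU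
  rw [eigenLowerBound_eq, div_lt_iff₀ hR]
  rwa [← mul_div_assoc, one_lt_div hU] at hone_lt

end DirichletInverse

section Asymptotics

lemma eigenUpperBound_div_sq (n : ℕ) :
    (eigenUpperBound n / (√2 * ((2 * n).factorial : ℝ))) ^ 2 =
      Real.Wallis.W n / Real.Wallis.W (2 * n) * (2 * (2 * n + 1) / (4 * n + 1)) := by
  have := halfPochhammer_pos n
  have := halfPochhammer_pos (2 * n)
  rw [eigenUpperBound_eq, wallis_eq_halfPochhammer, wallis_eq_halfPochhammer, div_pow, mul_pow √2,
    Real.sq_sqrt zero_le_two]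
  push_cast
  field_simp
  ring

lemma tendsto_two_mul_two_mul_add_one_div :
    Tendsto (fun n : ℕ => (2 * (2 * n + 1) : ℝ) / (4 * n + 1)) atTop (𝓝 1) := by
  have hlim : Tendsto (fun n : ℕ => (1 : ℝ) + 1 / ((4 * n : ℕ) + 1)) atTop (𝓝 (1 + 0)) :=
    ((tendsto_one_div_add_atTop_nhds_zero_nat (𝕜 := ℝ)).comp
      (tendsto_id.const_mul_atTop' four_pos)).const_add 1
  rw [add_zero] at hlim
  refine hlim.congr fun n => ?_
  push_cast
  field_simp
  ring

theorem eigenUpperBound_isEquivalent :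
    eigenUpperBound ~[atTop] fun n : ℕ => √2 * ((2 * n).factorial : ℝ) := by
  have hW := Real.Wallis.tendsto_W_nhds_pi_div_two
  have hquotient : Tendsto (fun n : ℕ => Real.Wallis.W n / Real.Wallis.W (2 * n)) atTop (𝓝 1) := by
    have := hW.div (hW.comp (tendsto_id.const_mul_atTop' two_pos)) (by positivity)
    rwa [div_self (by positivity)] at this
  have hsqrt := (hquotient.mul tendsto_two_mul_two_mul_add_one_div).sqrt
  rw [mul_one, Real.sqrt_one] at hsqrt
  refine isEquivalent_of_tendsto_one (hsqrt.congr fun n => ?_)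
  have := eigenUpperBound_pos n
  rw [← eigenUpperBound_div_sq, Real.sqrt_sq (by positivity), Pi.div_apply]

lemma tendsto_inv_ratioR : Tendsto (fun n => (ratioR n)⁻¹) atTop (𝓝 1) := by
  simpa using tendsto_ratioR.inv₀ one_ne_zero

lemma eigenLowerBound_div_eigenUpperBound (n : ℕ) :
    eigenLowerBound n / eigenUpperBound n = (ratioR n)⁻¹ := by
  rw [eigenLowerBound_eq, div_div_cancel_left' (eigenUpperBound_pos n).ne']

theorem eigenLowerBound_isEquivalent : eigenLowerBound ~[atTop] eigenUpperBound :=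
  isEquivalent_of_tendsto_one
    (tendsto_inv_ratioR.congr fun n => (eigenLowerBound_div_eigenUpperBound n).symm)

theorem minEigenvalue_isEquivalent : minEigenvalue ~[atTop] eigenUpperBound := by
  refine isEquivalent_of_tendsto_one <|
    tendsto_of_tendsto_of_tendsto_of_le_of_le' tendsto_inv_ratioR tendsto_const_nhds ?_ ?_ <;>
    filter_upwards [eventually_ge_atTop 1] with n hn
  · rw [← eigenLowerBound_div_eigenUpperBound]
    exact div_le_div_of_nonneg_right (eigenLowerBound_lt_minEigenvalue hn).le
      (eigenUpperBound_pos n).le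
  · exact div_le_one_of_le₀ (minEigenvalue_lt_eigenUpperBound hn).le (eigenUpperBound_pos n).le

end Asymptotics

end

theorem mainTheorem1 :
    (∀ n : ℕ, 1 ≤ n →
      IsLeast (polyharmonicEigenvalues n) (minEigenvalue n) ∧
        eigenLowerBound n < minEigenvalue n ∧ minEigenvalue n < eigenUpperBound n) ∧
    Tendsto ratioR atTop (𝓝 1) ∧
    (minEigenvalue ~[atTop] eigenLowerBound) ∧
    (minEigenvalue ~[atTop] eigenUpperBound) ∧
    (minEigenvalue ~[atTop] fun n : ℕ => Real.sqrt 2 * ((2 * n).factorial : ℝ)) := by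
  refine ⟨fun n hn => ⟨isLeast_minEigenvalue hn, eigenLowerBound_lt_minEigenvalue hn,
    minEigenvalue_lt_eigenUpperBound hn⟩, tendsto_ratioR, ?_, minEigenvalue_isEquivalent, ?_⟩
  · exact minEigenvalue_isEquivalent.trans eigenLowerBound_isEquivalent.symm
  · exact minEigenvalue_isEquivalent.trans eigenUpperBound_isEquivalent
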